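/- Let $n\ge 2$. For real $n\times n$ matrices $P,Q$ and $\gamma\in\mathbb R$ consider the biquadratic form $$F_\gamma(P,Q)=(2+\gamma)\bigl(\|P\|^2\|Q\|^2-\mathrm{trace}^2(P^TQ)\bigr)-\|PQ-QP\|^2$$ ($\|\cdot\|$ the Frobenius norm), a polynomial in the $2n^2$ entries of $P$ and $Q$. The smallest $\gamma$ for which $F_\gamma$ is a sum of squares of real polynomials is $\gamma_n=\frac{n-2}{2}$. Moreover, this value is attained by matching optimal solutions of a primal-dual pair of semidefinite programs, as follows. Order the $n^2$ matrix positions row by row, let $p,q\in\mathbb R^{n^2}$ be the vectors of entries of $P,Q$, put $z_{a,b}=p_aq_b-q_ap_b$ and let $z=(z_{a,b})_{a<b}$, a vector of length $N=\binom{n^2}{2}$. Let $C$ be the symmetric $N\times N$ matrix with $$z^TCz=2\sum_{a<b}z_{a,b}^2-\sum_{i,j=1}^n\Bigl(\sum_{k=1}^n z_{(i,k),(k,j)}\Bigr)^2,$$ identically as a quadratic form in independent variables $z_{a,b}$ $(a<b)$, with $z_{b,a}=-z_{a,b}$, $z_{a,a}=0$ (it takes the value $F_0(P,Q)$ at $z_{a,b}=p_aq_b-q_ap_b$).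 For $t=(a<b<c<d)$ let $A_t$ be the symmetric $N\times N$ matrix, with exactly six nonzero entries, all $\pm1$, such that $z^TA_tz=2(z_{a,b}z_{c,d}+z_{a,d}z_{b,c}-z_{a,c}z_{b,d})$. Then: (Primal) the minimum of $\mathrm{tr}(CX)$ over all positive semidefinite real symmetric $X$ with $\mathrm{tr}(A_tX)=0$ for all $t$ and $\mathrm{tr}(X)=1$ equals $\frac{2-n}{2}$, and it is attained at some such $X$ of rank $\binom n2$; (Dual) the maximum of $s$ over all real $(y_t)_t$ and $s$ for which the slack matrix $S=C-\sum_t y_tA_t-sI$ is positive semidefinite equals $\frac{2-n}{2}$, and it is attained. -/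

import Mathlib

/-! The scaled Böttcher-Wenzel form as a polynomial in the entries of `P` and `Q`, and the
primal and dual semidefinite programs attached to it. -/

namespace BW

noncomputable section

/-- The squared Frobenius norm of a square matrix, over any commutative ring. -/
def frobSq {R : Type*} [CommRing R] {n : ℕ} (A : Matrix (Fin n) (Fin n) R) : R :=
  ∑ i, ∑ j, A i j ^ 2

/-- Real polynomials in the `2 n ^ 2` entries of two `n × n` matrices. -/
abbrev Poly (n : ℕ) : Type := MvPolynomial ((Fin n × Fin n) ⊕ (Fin n × Fin n)) ℝ

/-- The generic matrix `P`, whose entries are indeterminates. -/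
def matP (n : ℕ) : Matrix (Fin n) (Fin n) (Poly n) :=
  Matrix.of fun i j => MvPolynomial.X (Sum.inl (i, j))

/-- The generic matrix `Q`, whose entries are indeterminates, disjoint from those of `P`. -/
def matQ (n : ℕ) : Matrix (Fin n) (Fin n) (Poly n) :=
  Matrix.of fun i j => MvPolynomial.X (Sum.inr (i, j))

/-- The biquadratic form `(2 + γ) (‖P‖² ‖Q‖² - trace² (Pᵀ Q)) - ‖P Q - Q P‖²`, as a polynomial. -/
def form (n : ℕ) (γ : ℝ) : Poly n :=
  MvPolynomial.C (2 + γ) *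
      (frobSq (matP n) * frobSq (matQ n) - (((matP n).transpose * matQ n).trace) ^ 2)
    - frobSq (matP n * matQ n - matQ n * matP n)

/-- Positions `(i, j)` in an `n × n` matrix, ordered row by row. -/
abbrev Pos (n : ℕ) : Type := Lex (Fin n × Fin n)

/-- The position `(i, j)`. -/
def pos {n : ℕ} (i j : Fin n) : Pos n := toLex (i, j)

/-- The indices of the candidates `z_{a,b} = p_a q_b - q_a p_b` with `a < b`;
there are `(n ^ 2).choose 2` of them. -/
abbrev Cand (n : ℕ) : Type := {c : Pos n × Pos n // c.1 < c.2}

/-- The coefficient vector of `z_{a,b}` with respect to the candidates: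
a unit vector if `a < b`, minus a unit vector if `b < a`, and zero if `a = b`. -/
def zvec {n : ℕ} (a b : Pos n) : Cand n → ℝ :=
  fun c => (if c.1 = (a, b) then 1 else 0) - (if c.1 = (b, a) then 1 else 0)

/-- The coefficient vector of the `(i, j)` entry of the commutator `P Q - Q P`,
which is the linear form `∑ k, z_{(i,k),(k,j)}` in the candidates. -/
def commVec {n : ℕ} (i j : Fin n) : Cand n → ℝ :=
  ∑ k, zvec (pos i k) (pos k j)

/-- The symmetric matrix `C` with
`zᵀ C z = 2 ∑_{a < b} z_{a,b} ^ 2 - ∑_{i,j} (∑ k, z_{(i,k),(k,j)}) ^ 2`. -/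
def matC (n : ℕ) : Matrix (Cand n) (Cand n) ℝ :=
  (2 : ℝ) • (1 : Matrix (Cand n) (Cand n) ℝ)
    - ∑ i : Fin n, ∑ j : Fin n, Matrix.vecMulVec (commVec i j) (commVec i j)

/-- The indices `a < b < c < d` of the quadratic relations; there are `(n ^ 2).choose 4` of them. -/
abbrev Quad (n : ℕ) : Type :=
  {t : Pos n × Pos n × Pos n × Pos n // t.1 < t.2.1 ∧ t.2.1 < t.2.2.1 ∧ t.2.2.1 < t.2.2.2}

/-- The symmetric matrix whose quadratic form is `2 x y`, for linear forms `x` and `y` with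
coefficient vectors `u` and `v`. -/
def symProd {n : ℕ} (u v : Cand n → ℝ) : Matrix (Cand n) (Cand n) ℝ :=
  Matrix.vecMulVec u v + Matrix.vecMulVec v u

/-- The constraint matrix of the relation
`z_{a,b} z_{c,d} + z_{a,d} z_{b,c} - z_{a,c} z_{b,d} = 0`, with six nonzero entries `±1`. -/
def matA {n : ℕ} (t : Quad n) : Matrix (Cand n) (Cand n) ℝ :=
  symProd (zvec t.1.1 t.1.2.1) (zvec t.1.2.2.1 t.1.2.2.2)
    + symProd (zvec t.1.1 t.1.2.2.2) (zvec t.1.2.1 t.1.2.2.1)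
    - symProd (zvec t.1.1 t.1.2.2.1) (zvec t.1.2.1 t.1.2.2.2)

/-- Feasibility for the primal program: minimize `tr (C X)` over positive semidefinite `X` with
`tr (A_t X) = 0` for all `t` and `tr X = 1`. -/
def PrimalFeasible {n : ℕ} (X : Matrix (Cand n) (Cand n) ℝ) : Prop :=
  X.PosSemidef ∧ (∀ t : Quad n, (matA t * X).trace = 0) ∧ X.trace = 1

/-- The slack matrix `C - ∑ t, y_t A_t - s I`. -/
def slack {n : ℕ} (y : Quad n → ℝ) (s : ℝ) : Matrix (Cand n) (Cand n) ℝ :=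
  matC n - ∑ t, y t • matA t - s • (1 : Matrix (Cand n) (Cand n) ℝ)

/-- Feasibility for the dual program: maximize `s` over all `y` and `s` with positive semidefinite
slack matrix. -/
def DualFeasible {n : ℕ} (y : Quad n → ℝ) (s : ℝ) : Prop :=
  (slack y s).PosSemidef

end

end BW

/-! Let `w` be the vector of minors of `(P, Q)`. Then `F_γ = wᵀ (C + γ I) w`, and a symmetric matrix
whose quadratic form vanishes at all such `w` is a combination of the `A_t` (`exists_eq_sum_matA`).
In a sum of squares equal to `F_γ`, only the quadratic part of each squared polynomial contributes,
and it is linear in the minors (`isGram_coeff_ray`). So a sum of squares for `F_γ` yields a dual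
feasible point with `s = -γ`. By weak duality (`le_trace_of_dualFeasible`) it remains to exhibit a
sum of squares and a primal point with the matching value `(2 - n) / 2`.

Sum of squares: split `P = S₁ + K₁` and `Q = S₂ + K₂` into symmetric and skew parts, so that the
minors split into `Λ² Sym`, `Λ² Skew` and `Sym ⊗ Skew`. The commutator couples the first two blocks
through `⟨[S₁, S₂], [K₁, K₂]⟩`; the trace identity `ip_comm_comm`, valid only at decomposable
vectors, moves this term into the third. The blocks are then separate: the commutator enters the
pure blocks through a contraction of the tensor, and the mixed block through a contraction and a
swap of the middle indices. Subtracting suitable Kronecker-delta tensors completes the squares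
(`formVal_eq_sum_sq`).

Primal point: the multiple of trace one of the projection onto the span of the coefficient vectors
of the entries of `[P + Pᵀ, Q + Qᵀ]`. For `g < h` these vectors are orthogonal, have equal length
and give `C` the value `(2 - n) / 2` per unit squared length. The constraints hold by the Jacobi
identity (`ip_commutator_jacobi`). -/

namespace BW

noncomputable section

open Matrix

variable {n : ℕ}

/-! ### Minors of a pair of matrices and the quadratic form of `C`. -/

/-- The vector of the minors `p_a q_b - q_a p_b`, for `a < b`. -/
def wedge (p q : Pos n → ℝ) : Cand n → ℝ :=
  fun c => p c.1.1 * q c.1.2 - q c.1.1 * p c.1.2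

lemma sum_pos {M : Type*} [AddCommMonoid M] (f : Pos n → M) :
    ∑ a, f a = ∑ i, ∑ j, f (pos i j) := by
  rw [← Fintype.sum_prod_type']
  exact (Equiv.sum_comp toLex f).symm

/-- Antisymmetry of `f` matches the sign convention of `zvec`, so sums may later run over all
positions instead of `a < b`. -/
lemma zvec_dotProduct (a b : Pos n) (f : Pos n → Pos n → ℝ) (hf : ∀ x y, f y x = -f x y) :
    zvec a b ⬝ᵥ (fun c : Cand n => f c.1.1 c.1.2) = f a b := by
  have h0 : ∀ x, f x x = 0 := fun x => by have := hf x x; linarith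
  have key : ∀ x y : Pos n, ∑ c : Cand n, (if c.1 = (x, y) then (1 : ℝ) else 0) * f c.1.1 c.1.2
      = if x < y then f x y else 0 := by
    intro x y
    by_cases h : x < y
    · rw [Finset.sum_eq_single (⟨(x, y), h⟩ : Cand n)]
      · simp [h]
      · intro c _ hc
        have : c.1 ≠ (x, y) := fun h' => hc (Subtype.ext h')
        simp [this]
      · simp
    · rw [if_neg h]
      refine Finset.sum_eq_zero fun c _ => ?_
      have : c.1 ≠ (x, y) := fun h' => h (by have := c.2; rw [h'] at this; exact this)
      simp [this]
  simp only [dotProduct, zvec, sub_mul, Finset.sum_sub_distrib, key]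
  rcases lt_trichotomy a b with h | h | h
  · simp [h, h.not_gt]
  · subst h; simp [h0]
  · simp [h, h.not_gt, hf b a]

lemma zvec_dotProduct_wedge (a b : Pos n) (p q : Pos n → ℝ) :
    zvec a b ⬝ᵥ wedge p q = p a * q b - q a * p b :=
  zvec_dotProduct a b (fun x y => p x * q y - q x * p y) fun x y => by ring

lemma zvec_dotProduct_zvec (a b c d : Pos n) :
    zvec a b ⬝ᵥ zvec c d = (if a = c ∧ b = d then 1 else 0) - (if a = d ∧ b = c then 1 else 0) := by
  have h := zvec_dotProduct a b
    (fun x y => (if x = c ∧ y = d then (1 : ℝ) else 0) - (if x = d ∧ y = c then 1 else 0))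
    (fun x y => by simp only [and_comm (a := y = _)]; ring)
  rw [← h]
  congr 1
  funext e
  simp [zvec, Prod.ext_iff]

lemma zvec_swap (a b : Pos n) : zvec b a = -zvec a b := by
  funext c; simp [zvec]

lemma wedge_eq_sum (p q : Pos n → ℝ) :
    wedge p q = ∑ a, ∑ b, (p a * q b) • zvec a b := by
  funext c
  simp only [Finset.sum_apply, Pi.smul_apply, zvec, smul_eq_mul, mul_sub, Finset.sum_sub_distrib,
    wedge, Prod.ext_iff, mul_ite, mul_one, mul_zero, ite_and]
  congr 1
  · simp
  · rw [Finset.sum_comm]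
    simp [mul_comm]

lemma dotProduct_wedge (v : Cand n → ℝ) (p q : Pos n → ℝ) :
    v ⬝ᵥ wedge p q = ∑ a, ∑ b, p a * q b * (zvec a b ⬝ᵥ v) := by
  rw [wedge_eq_sum, dotProduct_comm]
  simp only [sum_dotProduct, smul_dotProduct, smul_eq_mul]

/-- Lagrange's identity. -/
lemma wedge_dotProduct_wedge (p q : Pos n → ℝ) :
    wedge p q ⬝ᵥ wedge p q = (∑ a, p a ^ 2) * (∑ a, q a ^ 2) - (∑ a, p a * q a) ^ 2 := by
  rw [dotProduct_wedge, sq (∑ a, p a * q a), Finset.sum_mul_sum, Finset.sum_mul_sum,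
    ← Finset.sum_sub_distrib]
  refine Finset.sum_congr rfl fun a _ => ?_
  rw [← Finset.sum_sub_distrib]
  refine Finset.sum_congr rfl fun b _ => ?_
  rw [zvec_dotProduct_wedge]; ring

/-- The square matrix with the given entries. -/
def toMat (p : Pos n → ℝ) : Matrix (Fin n) (Fin n) ℝ := Matrix.of fun i j => p (pos i j)

@[simp] lemma toMat_apply (p : Pos n → ℝ) (i j : Fin n) : toMat p i j = p (pos i j) := rfl

/-- The point of the space of pairs of matrices with the given entries. -/
def pt (p q : Pos n → ℝ) : (Fin n × Fin n) ⊕ (Fin n × Fin n) → ℝ :=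
  Sum.elim (fun a => p (toLex a)) (fun a => q (toLex a))

/-- The value of the form at a pair of real matrices. -/
def formVal (γ : ℝ) (P Q : Matrix (Fin n) (Fin n) ℝ) : ℝ :=
  (2 + γ) * (frobSq P * frobSq Q - ((Pᵀ * Q).trace) ^ 2) - frobSq (P * Q - Q * P)

lemma eval_form (γ : ℝ) (p q : Pos n → ℝ) :
    MvPolynomial.eval (pt p q) (form n γ) = formVal γ (toMat p) (toMat q) := by
  simp [form, formVal, frobSq, Matrix.trace, Matrix.mul_apply, matP, matQ, pt, pos]

lemma commVec_dotProduct_wedge (i j : Fin n) (p q : Pos n → ℝ) :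
    commVec i j ⬝ᵥ wedge p q = (toMat p * toMat q - toMat q * toMat p) i j := by
  simp [commVec, sum_dotProduct, zvec_dotProduct_wedge, Matrix.mul_apply]

lemma dotProduct_matC (v : Cand n → ℝ) :
    v ⬝ᵥ (matC n *ᵥ v) = 2 * (v ⬝ᵥ v) - ∑ i, ∑ j, (commVec i j ⬝ᵥ v) ^ 2 := by
  simp only [matC, Matrix.sub_mulVec, Matrix.smul_mulVec, Matrix.one_mulVec, dotProduct_sub,
    dotProduct_smul, smul_eq_mul, Matrix.sum_mulVec, dotProduct_sum, Matrix.vecMulVec_mulVec]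
  congr 1
  refine Finset.sum_congr rfl fun i _ => Finset.sum_congr rfl fun j _ => ?_
  simp [dotProduct_comm v, sq]

lemma formVal_eq (γ : ℝ) (p q : Pos n → ℝ) :
    formVal γ (toMat p) (toMat q)
      = wedge p q ⬝ᵥ ((matC n + γ • (1 : Matrix (Cand n) (Cand n) ℝ)) *ᵥ wedge p q) := by
  rw [Matrix.add_mulVec, dotProduct_add, dotProduct_matC, Matrix.smul_mulVec, Matrix.one_mulVec,
    dotProduct_smul, wedge_dotProduct_wedge]
  simp only [commVec_dotProduct_wedge, sum_pos, formVal, frobSq, toMat_apply, Matrix.trace,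
    Matrix.diag, Matrix.mul_apply, Matrix.transpose_apply, smul_eq_mul]
  rw [Finset.sum_comm (f := fun i j => p (pos j i) * q (pos j i))]
  ring

lemma matC_transpose : (matC n)ᵀ = matC n := by
  simp [matC, Matrix.transpose_sum, Matrix.transpose_vecMulVec]

/-! ### Quadratic relations between the minors. -/

lemma wedge_add_left (p p' q : Pos n → ℝ) : wedge (p + p') q = wedge p q + wedge p' q := by
  funext c; simp only [wedge, Pi.add_apply]; ring

lemma wedge_add_right (p q q' : Pos n → ℝ) : wedge p (q + q') = wedge p q + wedge p q' := by
  funext c; simp only [wedge, Pi.add_apply]; ring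

lemma wedge_single (a b : Pos n) : wedge (Pi.single a 1) (Pi.single b 1) = zvec a b := by
  funext c
  simp only [wedge, zvec, Pi.single_apply, Prod.ext_iff, ite_and]
  congr 1
  · split_ifs <;> simp
  · split_ifs <;> simp

lemma zvec_cand (c : Cand n) : zvec c.1.1 c.1.2 = Pi.single c 1 := by
  funext d
  have h : d.1 ≠ (c.1.2, c.1.1) := by
    intro h
    have hd := d.2
    rw [h] at hd
    exact lt_asymm hd c.2
  simp [zvec, h, Pi.single_apply, Subtype.ext_iff]

lemma dotProduct_mulVec_symm {ι : Type*} [Fintype ι] {M : Matrix ι ι ℝ} (hM : Mᵀ = M)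
    (x y : ι → ℝ) : x ⬝ᵥ (M *ᵥ y) = y ⬝ᵥ (M *ᵥ x) := by
  rw [dotProduct_mulVec, ← mulVec_transpose, hM, dotProduct_comm]

/-- The entries of a sum of constraint matrices whose coefficients come from a function on all
quadruples of positions. -/
lemma sum_quad_apply (m : Pos n → Pos n → Pos n → Pos n → ℝ) (x : Pos n × Pos n × Pos n × Pos n) :
    ∑ t : Quad n, (if t.1 = x then m t.1.1 t.1.2.1 t.1.2.2.1 t.1.2.2.2 else 0)
      = if x.1 < x.2.1 ∧ x.2.1 < x.2.2.1 ∧ x.2.2.1 < x.2.2.2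
        then m x.1 x.2.1 x.2.2.1 x.2.2.2 else 0 := by
  by_cases h : x.1 < x.2.1 ∧ x.2.1 < x.2.2.1 ∧ x.2.2.1 < x.2.2.2
  · rw [Finset.sum_eq_single (⟨x, h⟩ : Quad n)]
    · simp [h]
    · intro t _ ht
      rw [if_neg fun h' => ht (Subtype.ext h')]
    · simp
  · rw [if_neg h]
    refine Finset.sum_eq_zero fun t _ => if_neg fun h' => h (by rw [← h']; exact t.2)

lemma zvec_apply_of_lt {a b : Pos n} (h : a < b) (c : Cand n) :
    zvec a b c = if a = c.1.1 ∧ b = c.1.2 then 1 else 0 := by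
  have h' : c.1 ≠ (b, a) := by
    intro h'
    have hc := c.2
    rw [h'] at hc
    exact lt_asymm hc h
  simp [zvec, h', Prod.ext_iff, eq_comm]

lemma sum_smul_matA_apply (m : Pos n → Pos n → Pos n → Pos n → ℝ) (c d : Cand n) :
    (∑ t : Quad n, m t.1.1 t.1.2.1 t.1.2.2.1 t.1.2.2.2 • matA t) c d
      = ((if c.1.1 < c.1.2 ∧ c.1.2 < d.1.1 ∧ d.1.1 < d.1.2
            then m c.1.1 c.1.2 d.1.1 d.1.2 else 0)
        + (if d.1.1 < d.1.2 ∧ d.1.2 < c.1.1 ∧ c.1.1 < c.1.2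
            then m d.1.1 d.1.2 c.1.1 c.1.2 else 0))
      + ((if c.1.1 < d.1.1 ∧ d.1.1 < d.1.2 ∧ d.1.2 < c.1.2
            then m c.1.1 d.1.1 d.1.2 c.1.2 else 0)
        + (if d.1.1 < c.1.1 ∧ c.1.1 < c.1.2 ∧ c.1.2 < d.1.2
            then m d.1.1 c.1.1 c.1.2 d.1.2 else 0))
      - ((if c.1.1 < d.1.1 ∧ d.1.1 < c.1.2 ∧ c.1.2 < d.1.2
            then m c.1.1 d.1.1 c.1.2 d.1.2 else 0)
        + (if d.1.1 < c.1.1 ∧ c.1.1 < d.1.2 ∧ d.1.2 < c.1.2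
            then m d.1.1 c.1.1 d.1.2 c.1.2 else 0)) := by
  have e1 := sum_quad_apply m (c.1.1, c.1.2, d.1.1, d.1.2)
  have e2 := sum_quad_apply m (d.1.1, d.1.2, c.1.1, c.1.2)
  have e3 := sum_quad_apply m (c.1.1, d.1.1, d.1.2, c.1.2)
  have e4 := sum_quad_apply m (d.1.1, c.1.1, c.1.2, d.1.2)
  have e5 := sum_quad_apply m (c.1.1, d.1.1, c.1.2, d.1.2)
  have e6 := sum_quad_apply m (d.1.1, c.1.1, d.1.2, c.1.2)
  simp only at e1 e2 e3 e4 e5 e6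
  rw [← e1, ← e2, ← e3, ← e4, ← e5, ← e6]
  simp only [← Finset.sum_add_distrib, ← Finset.sum_sub_distrib, Matrix.sum_apply]
  refine Finset.sum_congr rfl fun t _ => ?_
  obtain ⟨⟨t1, t2, t3, t4⟩, h12, h23, h34⟩ := t
  simp only at h12 h23 h34
  have h13 := h12.trans h23
  have h24 := h23.trans h34
  have h14 := h13.trans h34
  simp only [matA, symProd, Matrix.smul_apply, Matrix.add_apply, Matrix.sub_apply,
    Matrix.vecMulVec_apply, zvec_apply_of_lt h12, zvec_apply_of_lt h34, zvec_apply_of_lt h14,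
    zvec_apply_of_lt h23, zvec_apply_of_lt h13, zvec_apply_of_lt h24, smul_eq_mul, Prod.mk.injEq,
    mul_add, mul_sub, mul_ite, mul_one, mul_zero, ite_and]
  have key : ∀ (A B C D A' B' C' D' : Prop) [Decidable A] [Decidable B] [Decidable C] [Decidable D]
      [Decidable A'] [Decidable B'] [Decidable C'] [Decidable D'] (x : ℝ),
      (A ∧ B ∧ C ∧ D ↔ A' ∧ B' ∧ C' ∧ D') →
      (if A then if B then if C then if D then x else 0 else 0 else 0 else 0)
      = (if A' then if B' then if C' then if D' then x else 0 else 0 else 0 else 0) := by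
    intro A B C D A' B' C' D' _ _ _ _ _ _ _ _ x h
    simp only [← ite_and]
    exact if_congr (by tauto) rfl rfl
  congr 1
  · congr 1
    · congr 1 <;> exact key _ _ _ _ _ _ _ _ _ (by tauto)
    · congr 1 <;> exact key _ _ _ _ _ _ _ _ _ (by tauto)
  · congr 1 <;> exact key _ _ _ _ _ _ _ _ _ (by tauto)

/-- A symmetric matrix whose quadratic form vanishes at all decomposable vectors is a combination
of the constraint matrices. -/
lemma exists_eq_sum_matA {M : Matrix (Cand n) (Cand n) ℝ} (hM : Mᵀ = M)
    (h : ∀ p q : Pos n → ℝ, wedge p q ⬝ᵥ (M *ᵥ wedge p q) = 0) :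
    ∃ y : Quad n → ℝ, M = ∑ t, y t • matA t := by
  -- Polarise first in `q`, then in `p`: exchanging `p` and `p'` changes the sign.
  have h1 : ∀ p q q' : Pos n → ℝ, wedge p q ⬝ᵥ (M *ᵥ wedge p q') = 0 := by
    intro p q q'
    have e := h p (q + q')
    simp only [wedge_add_right, mulVec_add, add_dotProduct, dotProduct_add, h] at e
    rw [dotProduct_mulVec_symm hM (wedge p q') (wedge p q)] at e
    linarith
  have h2 : ∀ p p' q q' : Pos n → ℝ,
      wedge p q ⬝ᵥ (M *ᵥ wedge p' q') = -(wedge p' q ⬝ᵥ (M *ᵥ wedge p q')) := by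
    intro p p' q q'
    have e := h1 (p + p') q q'
    simp only [wedge_add_left, mulVec_add, add_dotProduct, dotProduct_add, h1] at e
    linarith
  -- The swaps below show that `m` is alternating in all four arguments, hence determined by its
  -- values at increasing quadruples.
  set m : Pos n → Pos n → Pos n → Pos n → ℝ := fun a b c d => zvec a b ⬝ᵥ (M *ᵥ zvec c d) with hm
  have m1 : ∀ a b c d, m b a c d = -m a b c d := by
    intro a b c d; simp only [hm, zvec_swap a b, neg_dotProduct]
  have m3 : ∀ a b c d, m a b d c = -m a b c d := by
    intro a b c d; simp only [hm, zvec_swap c d, mulVec_neg, dotProduct_neg]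
  have m2 : ∀ a b c d, m c b a d = -m a b c d := by
    intro a b c d
    simp only [hm, ← wedge_single]
    exact h2 _ _ _ _
  have m4 : ∀ a b c d, m a c b d = -m a b c d := by
    intro a b c d
    rw [m1 c a b d, m2 b a c d, m1 a b c d]; ring
  have z1 : ∀ a c d, m a a c d = 0 := fun a c d => by have := m1 a a c d; linarith
  have z2 : ∀ a b d, m a b b d = 0 := fun a b d => by have := m4 a b b d; linarith
  have z3 : ∀ a b d, m a b a d = 0 := fun a b d => by have := m2 a b a d; linarith
  have z4 : ∀ a b c, m a b c b = 0 := fun a b c => by have := m3 a b b c; rw [z2] at this; linarith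
  have z5 : ∀ a b c, m a b c a = 0 := fun a b c => by have := m3 a b a c; rw [z3] at this; linarith
  refine ⟨fun t => m t.1.1 t.1.2.1 t.1.2.2.1 t.1.2.2.2, ?_⟩
  ext c d
  rw [sum_smul_matA_apply]
  have hcd : M c d = m c.1.1 c.1.2 d.1.1 d.1.2 := by
    simp [hm, zvec_cand]
  rw [hcd]
  obtain ⟨⟨a, b⟩, hab⟩ := c
  obtain ⟨⟨c, d⟩, hcd'⟩ := d
  simp only at hab hcd' ⊢
  have r1 : m c d a b = m a b c d := by
    rw [m4 c a d b, m1 a c d b, m3 a c b d, m4 a b c d]; ring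
  have r2 : m a c d b = m a b c d := by
    rw [m3 a c b d, m4 a b c d]; ring
  have r3 : m c a b d = m a b c d := by
    rw [m1 a c b d, m4 a b c d]; ring
  have r4 : m a c b d = -m a b c d := m4 a b c d
  have r5 : m c a d b = -m a b c d := by
    rw [m1 a c d b, r2]
  rw [r1, r2, r3, r4, r5]
  clear_value m
  -- Every branch now carries `m a b c d`. For distinct positions exactly one of the six order
  -- patterns holds; a shared position makes both sides zero.
  rcases lt_trichotomy a c with h1 | h1 | h1
  · rcases lt_trichotomy b c with h2 | h2 | h2
    · have := h2.trans hcd'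
      simp [*, lt_asymm, hab.trans this]
    · subst h2
      simp [z2]
    · rcases lt_trichotomy b d with h3 | h3 | h3
      · simp [*, h1.not_gt, h2.not_gt, h3.not_gt, (h1.trans hcd').not_gt]
      · subst h3
        simp [z4]
      · simp [*, h1.not_gt, h2.not_gt, h3.not_gt, (h1.trans hcd').not_gt]
  · subst h1
    simp [z3]
  · rcases lt_trichotomy a d with h2 | h2 | h2
    · rcases lt_trichotomy b d with h3 | h3 | h3
      · simp [*, h1.not_gt, h2.not_gt, h3.not_gt, (h1.trans hab).not_gt]
      · subst h3
        simp [z4]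
      · simp [*, h1.not_gt, h2.not_gt, h3.not_gt, (h1.trans hab).not_gt]
    · subst h2
      simp [z5]
    · have := h2.trans hab
      simp [*, h1.not_gt, h2.not_gt, this.not_gt, (h1.trans hab).not_gt]

end

end BW

/-! ### Positive semidefinite matrices. -/

open Matrix

open scoped MatrixOrder in
lemma Matrix.PosSemidef.exists_eq_transpose_mul_self {ι : Type*} [Fintype ι] [DecidableEq ι] {A : Matrix ι ι ℝ} (h : A.PosSemidef) :
    ∃ B : Matrix ι ι ℝ, A = Bᵀ * B := by
  refine ⟨CFC.sqrt A, ?_⟩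
  have h2 : (CFC.sqrt A).PosSemidef := Matrix.nonneg_iff_posSemidef.mp (CFC.sqrt_nonneg A)
  have h3 : (CFC.sqrt A)ᵀ = CFC.sqrt A := by
    have := h2.isHermitian
    rwa [Matrix.IsHermitian, Matrix.conjTranspose_eq_transpose_of_trivial] at this
  rw [h3, CFC.sqrt_mul_sqrt_self A (Matrix.nonneg_iff_posSemidef.mpr h)]

lemma Matrix.PosSemidef.trace_mul_nonneg {ι : Type*} [Fintype ι] [DecidableEq ι] {A X : Matrix ι ι ℝ}
    (hA : A.PosSemidef) (hX : X.PosSemidef) : 0 ≤ (A * X).trace := by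
  obtain ⟨B, rfl⟩ := hA.exists_eq_transpose_mul_self
  rw [Matrix.mul_assoc, Matrix.trace_mul_comm, ← Matrix.conjTranspose_eq_transpose_of_trivial]
  exact (hX.mul_mul_conjTranspose_same B).trace_nonneg

lemma posSemidef_vecMulVec {ι : Type*} [Fintype ι] (v : ι → ℝ) : (vecMulVec v v).PosSemidef := by
  simpa using posSemidef_vecMulVec_self_star v

namespace BW

noncomputable section

open Matrix

variable {n : ℕ}

/-! ### The norm of a commutator in terms of symmetric and skew parts. -/

/-- The Frobenius inner product. -/
def ip (A B : Matrix (Fin n) (Fin n) ℝ) : ℝ := (Aᵀ * B).trace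

lemma ip_eq_sum (A B : Matrix (Fin n) (Fin n) ℝ) : ip A B = ∑ i, ∑ j, A i j * B i j := by
  simp only [ip, Matrix.trace, Matrix.diag, Matrix.mul_apply, Matrix.transpose_apply]
  exact Finset.sum_comm

lemma frobSq_eq_ip (A : Matrix (Fin n) (Fin n) ℝ) : frobSq A = ip A A := by
  simp [ip_eq_sum, frobSq, sq]

lemma ip_add_left (A B C : Matrix (Fin n) (Fin n) ℝ) : ip (A + B) C = ip A C + ip B C := by
  simp [ip, Matrix.add_mul]

lemma ip_add_right (A B C : Matrix (Fin n) (Fin n) ℝ) : ip A (B + C) = ip A B + ip A C := by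
  simp [ip, Matrix.mul_add]

lemma ip_sub_left (A B C : Matrix (Fin n) (Fin n) ℝ) : ip (A - B) C = ip A C - ip B C := by
  simp [ip, Matrix.sub_mul]

lemma ip_sub_right (A B C : Matrix (Fin n) (Fin n) ℝ) : ip A (B - C) = ip A B - ip A C := by
  simp [ip, Matrix.mul_sub]

lemma ip_smul_left (x : ℝ) (A B : Matrix (Fin n) (Fin n) ℝ) : ip (x • A) B = x * ip A B := by
  simp [ip]

lemma ip_comm (A B : Matrix (Fin n) (Fin n) ℝ) : ip A B = ip B A := by
  simp [ip_eq_sum, mul_comm]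

lemma ip_transpose (A B : Matrix (Fin n) (Fin n) ℝ) : ip Aᵀ Bᵀ = ip A B := by
  simp only [ip_eq_sum, Matrix.transpose_apply]
  exact Finset.sum_comm

lemma ip_eq_zero {A B : Matrix (Fin n) (Fin n) ℝ} (hA : Aᵀ = -A) (hB : Bᵀ = B) : ip A B = 0 := by
  have h := ip_transpose A B
  rw [hA, hB] at h
  have h' : ip (-A) B = -ip A B := by simp [ip]
  linarith

/-- Transposition reverses a product of four factors under the trace, so only the traces of `S₁ S₂
K₁ K₂` and `S₁ S₂ K₂ K₁` survive. The left side couples the two pure blocks, while the right side is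
a quadratic form in the mixed tensor `S₁ ⊗ K₂ - S₂ ⊗ K₁`. -/
lemma ip_comm_comm {S₁ S₂ K₁ K₂ : Matrix (Fin n) (Fin n) ℝ} (h1 : S₁ᵀ = S₁) (h2 : S₂ᵀ = S₂)
    (k1 : K₁ᵀ = -K₁) (k2 : K₂ᵀ = -K₂) :
    ip (S₁ * S₂ - S₂ * S₁) (K₁ * K₂ - K₂ * K₁)
      = 2 * ip (S₁ * K₂) (S₂ * K₁) - 2 * ip (S₁ * K₁) (S₂ * K₂) := by
  have e1 : (S₂ * S₁ * (K₁ * K₂)).trace = (S₁ * S₂ * (K₂ * K₁)).trace := by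
    rw [← Matrix.trace_transpose (S₂ * S₁ * (K₁ * K₂))]
    simp only [Matrix.transpose_mul, h1, h2, k1, k2, neg_mul, mul_neg, neg_neg]
    exact Matrix.trace_mul_comm _ _
  have e2 : (S₂ * S₁ * (K₂ * K₁)).trace = (S₁ * S₂ * (K₁ * K₂)).trace := by
    rw [← Matrix.trace_transpose (S₂ * S₁ * (K₂ * K₁))]
    simp only [Matrix.transpose_mul, h1, h2, k1, k2, neg_mul, mul_neg, neg_neg]
    exact Matrix.trace_mul_comm _ _
  have e3 : ip (S₁ * K₂) (S₂ * K₁) = -(S₁ * S₂ * (K₁ * K₂)).trace := by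
    simp only [ip, Matrix.transpose_mul, h1, k2, neg_mul, Matrix.trace_neg]
    rw [Matrix.mul_assoc, Matrix.trace_mul_comm]
    simp only [Matrix.mul_assoc]
  have e4 : ip (S₁ * K₁) (S₂ * K₂) = -(S₁ * S₂ * (K₂ * K₁)).trace := by
    simp only [ip, Matrix.transpose_mul, h1, k1, neg_mul, Matrix.trace_neg]
    rw [Matrix.mul_assoc, Matrix.trace_mul_comm]
    simp only [Matrix.mul_assoc]
  rw [e3, e4]
  simp only [ip, Matrix.transpose_sub, Matrix.transpose_mul, h1, h2, Matrix.sub_mul,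
    Matrix.mul_sub, Matrix.trace_sub, e1, e2]
  ring

/-- The squared norm of a commutator in terms of symmetric and skew parts. -/
lemma ip_commutator {S₁ S₂ K₁ K₂ : Matrix (Fin n) (Fin n) ℝ} (h1 : S₁ᵀ = S₁) (h2 : S₂ᵀ = S₂)
    (k1 : K₁ᵀ = -K₁) (k2 : K₂ᵀ = -K₂) :
    frobSq ((S₁ + K₁) * (S₂ + K₂) - (S₂ + K₂) * (S₁ + K₁))
      = frobSq (S₁ * S₂ - S₂ * S₁) + frobSq (K₁ * K₂ - K₂ * K₁)
        + 2 * (ip (S₁ * K₂) (S₁ * K₂) + ip (S₂ * K₁) (S₂ * K₁) - 2 * ip (S₁ * K₁) (S₂ * K₂))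
        + 2 * ip (S₁ * K₂ - S₂ * K₁) (S₁ * K₂ - S₂ * K₁)ᵀ := by
  set A := S₁ * S₂ - S₂ * S₁ with hA
  set A' := K₁ * K₂ - K₂ * K₁ with hA'
  set E := S₁ * K₂ - S₂ * K₁ with hE
  have hAt : (A + A')ᵀ = -(A + A') := by
    simp only [hA, hA', Matrix.transpose_add, Matrix.transpose_sub, Matrix.transpose_mul, h1, h2,
      k1, k2]
    noncomm_ring
  have hEt : (E + Eᵀ)ᵀ = E + Eᵀ := by simp [add_comm]
  have e : (S₁ + K₁) * (S₂ + K₂) - (S₂ + K₂) * (S₁ + K₁) = (A + A') + (E + Eᵀ) := by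
    simp only [hA, hA', hE, Matrix.transpose_sub, Matrix.transpose_mul, h1, h2, k1, k2]
    noncomm_ring
  have h0 := ip_eq_zero hAt hEt
  have hEE : ip E E = ip (S₁ * K₂) (S₁ * K₂) + ip (S₂ * K₁) (S₂ * K₁)
      - 2 * ip (S₁ * K₂) (S₂ * K₁) := by
    rw [hE, ip_sub_left, ip_sub_right, ip_sub_right, ip_comm (S₂ * K₁) (S₁ * K₂)]
    ring
  have hc : ip A A' = _ := ip_comm_comm h1 h2 k1 k2
  simp only [frobSq_eq_ip]
  rw [e, ip_add_left (A + A'), ip_add_right _ (A + A'), ip_add_right _ (A + A'), h0,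
    ip_comm (E + Eᵀ) (A + A'), h0, ip_add_left A, ip_add_right A A A', ip_add_right A' A A', ip_comm A' A,
    ip_add_left E, ip_add_right E, ip_add_right Eᵀ, ip_comm Eᵀ E, ip_transpose, hEE, hc]
  ring

/-- The symmetric part for `ε = 1`, the skew part for `ε = -1`. -/
def part (ε : ℝ) (P : Matrix (Fin n) (Fin n) ℝ) : Matrix (Fin n) (Fin n) ℝ :=
  (1 / 2 : ℝ) • (P + ε • Pᵀ)

lemma part_apply (ε : ℝ) (P : Matrix (Fin n) (Fin n) ℝ) (i j : Fin n) :
    part ε P i j = (P i j + ε * P j i) / 2 := by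
  simp [part]; ring

lemma part_add_part (P : Matrix (Fin n) (Fin n) ℝ) : part 1 P + part (-1) P = P := by
  ext i j; simp only [Matrix.add_apply, part_apply]; ring

lemma part_swap {ε : ℝ} (hε : ε * ε = 1) (P : Matrix (Fin n) (Fin n) ℝ) (i j : Fin n) :
    part ε P j i = ε * part ε P i j := by
  simp only [part_apply]; linear_combination (-(P j i) / 2) * hε

lemma part_one_transpose (P : Matrix (Fin n) (Fin n) ℝ) : (part 1 P)ᵀ = part 1 P := by
  ext i j; simp only [Matrix.transpose_apply, part_apply]; ring

lemma part_neg_one_transpose (P : Matrix (Fin n) (Fin n) ℝ) : (part (-1) P)ᵀ = -part (-1) P := by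
  ext i j; simp only [Matrix.transpose_apply, Matrix.neg_apply, part_apply]; ring

/-! ### Tensor blocks, their contractions and the sum-of-squares identity. -/

/-- The component of `P ∧ Q` in the product of two parts. -/
def tens (ε δ : ℝ) (P Q : Matrix (Fin n) (Fin n) ℝ) (i k l j : Fin n) : ℝ :=
  part ε P i k * part δ Q l j - part ε Q i k * part δ P l j

/-- The contraction of `tens ε δ P Q` in its two middle indices. -/
def tensTrace (ε δ : ℝ) (P Q : Matrix (Fin n) (Fin n) ℝ) : Matrix (Fin n) (Fin n) ℝ :=
  part ε P * part δ Q - part ε Q * part δ P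

lemma sum_tens (ε δ : ℝ) (P Q : Matrix (Fin n) (Fin n) ℝ) (i j : Fin n) :
    ∑ k, tens ε δ P Q i k k j = tensTrace ε δ P Q i j := by
  simp [tens, tensTrace, Matrix.mul_apply]

lemma sum_tens_sq (A B C D : Matrix (Fin n) (Fin n) ℝ) :
    ∑ i, ∑ k, ∑ l, ∑ j, (A i k * B l j - C i k * D l j) ^ 2
      = ip A A * ip B B + ip C C * ip D D - 2 * ip A C * ip B D := by
  have h : ∀ X Y Z W : Matrix (Fin n) (Fin n) ℝ, ip X Y * ip Z W
      = ∑ i, ∑ k, ∑ l, ∑ j, X i k * Y i k * (Z l j * W l j) := by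
    intro X Y Z W
    simp only [ip_eq_sum, Finset.sum_mul]
    simp only [Finset.mul_sum]
  simp only [mul_assoc (2 : ℝ), h, Finset.mul_sum, ← Finset.sum_add_distrib,
    ← Finset.sum_sub_distrib]
  refine Finset.sum_congr rfl fun i _ => Finset.sum_congr rfl fun k _ => Finset.sum_congr rfl
    fun l _ => Finset.sum_congr rfl fun j _ => by ring

lemma sum_mul_swap (A B C D : Matrix (Fin n) (Fin n) ℝ) :
    ∑ i, ∑ k, ∑ l, ∑ j, A i k * B l j * (C i l * D k j) = ip (A * D) (C * B) := by
  simp only [ip_eq_sum, Matrix.mul_apply, Finset.sum_mul_sum]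
  refine Finset.sum_congr rfl fun i _ => ?_
  symm
  rw [Finset.sum_comm]
  refine Finset.sum_congr rfl fun k _ => ?_
  rw [Finset.sum_comm]
  refine Finset.sum_congr rfl fun l _ => Finset.sum_congr rfl fun j _ => by ring

lemma sum_tens_swap (A B C D : Matrix (Fin n) (Fin n) ℝ) :
    ∑ i, ∑ k, ∑ l, ∑ j, (A i k * B l j - C i k * D l j) * (A i l * B k j - C i l * D k j)
      = ip (A * B) (A * B) + ip (C * D) (C * D) - 2 * ip (A * D) (C * B) := by
  have h : ∀ i k l j, (A i k * B l j - C i k * D l j) * (A i l * B k j - C i l * D k j)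
      = A i k * B l j * (A i l * B k j) + C i k * D l j * (C i l * D k j)
        - A i k * B l j * (C i l * D k j) - C i k * D l j * (A i l * B k j) := by
    intros; ring
  simp only [h, Finset.sum_add_distrib, Finset.sum_sub_distrib, sum_mul_swap]
  rw [ip_comm (C * B) (A * D)]; ring

/-- The tensor built from a matrix by the Kronecker delta, with prescribed symmetry in the first
and in the last pair of indices. -/
def corr (ε δ : ℝ) (E : Matrix (Fin n) (Fin n) ℝ) (i k l j : Fin n) : ℝ :=
  (if k = l then 1 else 0) * E i j + ε * (if i = l then 1 else 0) * E k j
    + δ * (if k = j then 1 else 0) * E i l + ε * δ * (if i = j then 1 else 0) * E k l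

/-- `corr` symmetrises one delta term over four index swaps, and `f` has the same symmetry, so the
four terms contribute equally. -/
lemma sum_mul_corr {ε δ : ℝ} {f : Fin n → Fin n → Fin n → Fin n → ℝ} (h1 : ∀ i k l j, f k i l j = ε * f i k l j)
    (h2 : ∀ i k l j, f i k j l = δ * f i k l j) (E : Matrix (Fin n) (Fin n) ℝ) :
    ∑ i, ∑ k, ∑ l, ∑ j, f i k l j * corr ε δ E i k l j
      = 4 * ∑ i, ∑ j, (∑ k, f i k k j) * E i j := by
  set g : Fin n → Fin n → Fin n → Fin n → ℝ :=
    fun i k l j => f i k l j * ((if k = l then 1 else 0) * E i j) with hg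
  have hs : ∀ i k l j, f i k l j * corr ε δ E i k l j
      = g i k l j + g k i l j + g i k j l + g k i j l := by
    intro i k l j
    simp only [hg, corr]
    rw [h2 k i l j, h1 i k l j, h2 i k l j]
    ring
  have g0 : ∑ i, ∑ k, ∑ l, ∑ j, g i k l j = ∑ i, ∑ j, (∑ k, f i k k j) * E i j := by
    refine Finset.sum_congr rfl fun i _ => ?_
    simp only [Finset.sum_mul]
    rw [Finset.sum_comm (s := Finset.univ) (t := Finset.univ) (f := fun j k => f i k k j * E i j)]
    refine Finset.sum_congr rfl fun k _ => ?_
    rw [Finset.sum_comm]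
    refine Finset.sum_congr rfl fun j _ => ?_
    simp [hg]
  have g1 : ∑ i, ∑ k, ∑ l, ∑ j, g k i l j = ∑ i, ∑ k, ∑ l, ∑ j, g i k l j := Finset.sum_comm
  have g2 : ∑ i, ∑ k, ∑ l, ∑ j, g i k j l = ∑ i, ∑ k, ∑ l, ∑ j, g i k l j :=
    Finset.sum_congr rfl fun i _ => Finset.sum_congr rfl fun k _ => Finset.sum_comm
  have g3 : ∑ i, ∑ k, ∑ l, ∑ j, g k i j l = ∑ i, ∑ k, ∑ l, ∑ j, g i k l j := by
    rw [← g2]; exact Finset.sum_comm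
  simp only [hs, Finset.sum_add_distrib, g1, g2, g3, g0]
  ring

lemma corr_swap_left {ε : ℝ} (hε : ε * ε = 1) (δ : ℝ) (E : Matrix (Fin n) (Fin n) ℝ)
    (i k l j : Fin n) : corr ε δ E k i l j = ε * corr ε δ E i k l j := by
  simp only [corr]
  linear_combination (-((if i = l then 1 else 0) * E k j) - δ * (if i = j then 1 else 0) * E k l)
    * hε

lemma corr_swap_right (ε : ℝ) {δ : ℝ} (hδ : δ * δ = 1) (E : Matrix (Fin n) (Fin n) ℝ)
    (i k l j : Fin n) : corr ε δ E i k j l = δ * corr ε δ E i k l j := by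
  simp only [corr]
  linear_combination (-((if k = j then 1 else 0) * E i l) - ε * (if i = j then 1 else 0) * E k l)
    * hδ

lemma sum_corr (ε δ : ℝ) {E : Matrix (Fin n) (Fin n) ℝ} (hE : E.trace = 0) (i j : Fin n) :
    ∑ k, corr ε δ E i k k j = (n + ε + δ) * E i j := by
  have : ∑ k, E k k = 0 := hE
  simp only [corr, Finset.sum_add_distrib, ← Finset.mul_sum, this, mul_assoc]
  simp
  ring

/-- Both the cross term and the square of `corr` reduce to contractions. For `E = F` and `n + ε + δ
> 0` the right side is least at `x = 1 / (n + ε + δ)`. -/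
lemma sum_sub_corr_sq {ε δ : ℝ} (hε : ε * ε = 1) (hδ : δ * δ = 1)
    {f : Fin n → Fin n → Fin n → Fin n → ℝ} (h1 : ∀ i k l j, f k i l j = ε * f i k l j)
    (h2 : ∀ i k l j, f i k j l = δ * f i k l j) {E F : Matrix (Fin n) (Fin n) ℝ}
    (hE : E.trace = 0) (hF : ∀ i j, ∑ k, f i k k j = F i j) (x : ℝ) :
    ∑ i, ∑ k, ∑ l, ∑ j, (f i k l j - x * corr ε δ E i k l j) ^ 2
      = ∑ i, ∑ k, ∑ l, ∑ j, f i k l j ^ 2 - 8 * x * ip F E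
        + 4 * x ^ 2 * (n + ε + δ) * ip E E := by
  have e1 := sum_mul_corr h1 h2 E
  have e2 := sum_mul_corr (corr_swap_left hε δ E) (corr_swap_right ε hδ E) E
  simp only [hF, sum_corr ε δ hE, mul_assoc, ← Finset.mul_sum] at e1 e2
  rw [← ip_eq_sum] at e1 e2
  have hs : ∀ i k l j, (f i k l j - x * corr ε δ E i k l j) ^ 2 = f i k l j ^ 2
      - 2 * x * (f i k l j * corr ε δ E i k l j)
      + x ^ 2 * (corr ε δ E i k l j * corr ε δ E i k l j) := by intros; ring
  simp only [hs, Finset.sum_add_distrib, Finset.sum_sub_distrib, ← Finset.mul_sum, e1, e2]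
  ring

/-- After the swap, one delta term pairs a skew with a symmetric array and one meets the zero
diagonal of `f`; each of the other two gives `ip F E`. -/
lemma sum_mul_corr_swap {f : Fin n → Fin n → Fin n → Fin n → ℝ}
    (h1 : ∀ i k l j, f k i l j = f i k l j) (h2 : ∀ i k l j, f i k j l = -f i k l j)
    {E F : Matrix (Fin n) (Fin n) ℝ} (hE : Eᵀ = E) (hF : ∀ i j, ∑ k, f i k k j = F i j) :
    ∑ i, ∑ k, ∑ l, ∑ j, f i k l j * corr 1 (-1) E i l k j = 2 * ip F E := by
  have hE' : ∀ i j, E j i = E i j := fun i j => congrFun (congrFun hE i) j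
  have hd : ∀ i k j, f i k j j = 0 := fun i k j => by have := h2 i k j j; linarith
  have hs : ∀ i k l j, f i k l j * corr 1 (-1) E i l k j
      = (if l = k then f i k l j * E i j else 0) + (if i = k then f i k l j * E l j else 0)
        - (if l = j then f i k l j * E i k else 0) - (if i = j then f i k l j * E l k else 0) := by
    intros; simp only [corr]; split_ifs <;> ring
  have t1 : ∑ i, ∑ k, ∑ l, ∑ j, (if l = k then f i k l j * E i j else 0) = ip F E := by
    rw [ip_eq_sum]
    refine Finset.sum_congr rfl fun i _ => ?_
    simp only [← hF, Finset.sum_mul]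
    rw [Finset.sum_comm (s := Finset.univ) (t := Finset.univ) (f := fun j k => f i k k j * E i j)]
    refine Finset.sum_congr rfl fun k _ => ?_
    rw [Finset.sum_comm]
    simp
  have t2 : ∑ i, ∑ k, ∑ l, ∑ j, (if i = k then f i k l j * E l j else 0) = 0 := by
    refine Finset.sum_eq_zero fun i _ => Finset.sum_eq_zero fun k _ => ?_
    split_ifs
    · have : ∑ l, ∑ j, f i k l j * E l j = -∑ l, ∑ j, f i k l j * E l j := by
        conv_lhs => rw [Finset.sum_comm]
        simp only [← Finset.sum_neg_distrib]
        refine Finset.sum_congr rfl fun l _ => Finset.sum_congr rfl fun j _ => ?_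
        rw [h2 i k l j, hE' l j]; ring
      linarith
    · simp
  have t3 : ∑ i, ∑ k, ∑ l, ∑ j, (if l = j then f i k l j * E i k else 0) = 0 := by
    simp [hd]
  have t4 : ∑ i, ∑ k, ∑ l, ∑ j, (if i = j then f i k l j * E l k else 0) = -ip F E := by
    rw [ip_eq_sum, Finset.sum_comm, ← Finset.sum_neg_distrib]
    refine Finset.sum_congr rfl fun k _ => ?_
    rw [Finset.sum_comm, ← Finset.sum_neg_distrib]
    refine Finset.sum_congr rfl fun l _ => ?_
    rw [← hF, Finset.sum_mul, ← Finset.sum_neg_distrib]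
    refine Finset.sum_congr rfl fun i _ => ?_
    rw [Finset.sum_ite_eq, if_pos (Finset.mem_univ _), h2 i k i l, h1 k i i l, hE' k l]
    ring
  simp only [hs, Finset.sum_add_distrib, Finset.sum_sub_distrib, t1, t2, t3, t4]
  ring

lemma tens_swap_left {ε : ℝ} (hε : ε * ε = 1) (δ : ℝ) (P Q : Matrix (Fin n) (Fin n) ℝ)
    (i k l j : Fin n) : tens ε δ P Q k i l j = ε * tens ε δ P Q i k l j := by
  simp only [tens, part_swap hε _ i k]; ring

lemma tens_swap_right (ε : ℝ) {δ : ℝ} (hδ : δ * δ = 1) (P Q : Matrix (Fin n) (Fin n) ℝ)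
    (i k l j : Fin n) : tens ε δ P Q i k j l = δ * tens ε δ P Q i k l j := by
  simp only [tens, part_swap hδ _ l j]; ring

lemma trace_tensTrace_self (ε : ℝ) (P Q : Matrix (Fin n) (Fin n) ℝ) :
    (tensTrace ε ε P Q).trace = 0 := by
  rw [tensTrace, Matrix.trace_sub, Matrix.trace_mul_comm, sub_self]

lemma trace_mul_part (P Q : Matrix (Fin n) (Fin n) ℝ) : (part 1 P * part (-1) Q).trace = 0 := by
  have h := Matrix.trace_transpose (part 1 P * part (-1) Q)
  rw [Matrix.transpose_mul, part_one_transpose, part_neg_one_transpose, Matrix.neg_mul,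
    Matrix.trace_neg, Matrix.trace_mul_comm] at h
  linarith

/-- The component of `P ∧ Q` in a product of parts, corrected by a multiple of its contraction. -/
def resid (ε : ℝ) (P Q : Matrix (Fin n) (Fin n) ℝ) (i k l j : Fin n) : ℝ :=
  tens ε ε P Q i k l j - 1 / (n + 2 : ℝ) * corr ε ε (tensTrace ε ε P Q) i k l j

/-- The mixed component of `P ∧ Q`, corrected by the symmetric part of its contraction. -/
def mixed (P Q : Matrix (Fin n) (Fin n) ℝ) (i k l j : Fin n) : ℝ :=
  tens 1 (-1) P Q i k l j - 1 / (n : ℝ) * corr 1 (-1) (part 1 (tensTrace 1 (-1) P Q)) i k l j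

/-- The factor `1 / (n + 2)` is optimal for `ε = 1`. For `ε = -1` the optimum `1 / (n - 2)` would
break down at `n = 2`; the choice made here leaves the surplus `4 / (n + 2)` times a square in the
final identity. -/
lemma sum_resid_sq {ε : ℝ} (hε : ε * ε = 1) (P Q : Matrix (Fin n) (Fin n) ℝ) :
    ∑ i, ∑ k, ∑ l, ∑ j, resid ε P Q i k l j ^ 2
      = 2 * (frobSq (part ε P) * frobSq (part ε Q) - ip (part ε P) (part ε Q) ^ 2)
        - 8 * (1 / (n + 2 : ℝ)) * frobSq (tensTrace ε ε P Q)
        + 4 * (1 / (n + 2 : ℝ)) ^ 2 * (n + ε + ε) * frobSq (tensTrace ε ε P Q) := by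
  simp only [resid]
  rw [sum_sub_corr_sq hε hε (tens_swap_left hε ε P Q) (tens_swap_right ε hε P Q)
    (trace_tensTrace_self ε P Q) (sum_tens ε ε P Q)]
  have := sum_tens_sq (part ε P) (part ε Q) (part ε Q) (part ε P)
  simp only [tens]
  rw [this, frobSq_eq_ip, frobSq_eq_ip, frobSq_eq_ip, ip_comm (part ε Q) (part ε P)]
  ring

lemma ip_part (E : Matrix (Fin n) (Fin n) ℝ) :
    ip E (part 1 E) = frobSq (part 1 E) := by
  have h : ip (part (-1) E) (part 1 E) = 0 :=
    ip_eq_zero (part_neg_one_transpose E) (part_one_transpose E)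
  have h' : ip E (part 1 E) = ip (part 1 E + part (-1) E) (part 1 E) := by rw [part_add_part]
  rw [h', ip_add_left, h, frobSq_eq_ip, add_zero]

lemma ip_transpose_self (E : Matrix (Fin n) (Fin n) ℝ) :
    ip E Eᵀ = frobSq (part 1 E) - frobSq (part (-1) E) := by
  have h : ip (part (-1) E) (part 1 E) = 0 :=
    ip_eq_zero (part_neg_one_transpose E) (part_one_transpose E)
  have h' : ip E Eᵀ = ip (part 1 E + part (-1) E) (part 1 E - part (-1) E) := by
    congr 1
    · exact (part_add_part E).symm
    · ext i j; simp only [Matrix.transpose_apply, Matrix.sub_apply, part_apply]; ring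
  rw [h', ip_add_left, ip_sub_right, ip_sub_right, ip_comm (part 1 E) (part (-1) E), h,
    frobSq_eq_ip, frobSq_eq_ip]
  ring

lemma trace_part_tensTrace (P Q : Matrix (Fin n) (Fin n) ℝ) :
    (part 1 (tensTrace 1 (-1) P Q)).trace = 0 := by
  have h : (tensTrace 1 (-1) P Q).trace = 0 := by
    rw [tensTrace, Matrix.trace_sub, trace_mul_part, trace_mul_part, sub_zero]
  simp [part, h]

lemma sum_mixed_sq (hn : n ≠ 0) (P Q : Matrix (Fin n) (Fin n) ℝ) :
    ∑ i, ∑ k, ∑ l, ∑ j, mixed P Q i k l j ^ 2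
      = frobSq (part 1 P) * frobSq (part (-1) Q) + frobSq (part 1 Q) * frobSq (part (-1) P)
        - 2 * ip (part 1 P) (part 1 Q) * ip (part (-1) P) (part (-1) Q)
        - 4 / n * frobSq (part 1 (tensTrace 1 (-1) P Q)) := by
  have hn' : (n : ℝ) ≠ 0 := by exact_mod_cast hn
  simp only [mixed]
  rw [sum_sub_corr_sq (by norm_num) (by norm_num) (tens_swap_left (by norm_num) (-1) P Q)
    (tens_swap_right 1 (by norm_num) P Q) (trace_part_tensTrace P Q) (sum_tens 1 (-1) P Q)]
  have := sum_tens_sq (part 1 P) (part (-1) Q) (part 1 Q) (part (-1) P)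
  simp only [tens]
  rw [this, ip_part, ip_comm (part (-1) Q) (part (-1) P)]
  simp only [frobSq_eq_ip]
  field_simp
  ring

lemma sum_mixed_swap (hn : n ≠ 0) (P Q : Matrix (Fin n) (Fin n) ℝ) :
    ∑ i, ∑ k, ∑ l, ∑ j, mixed P Q i k l j * mixed P Q i l k j
      = ip (part 1 P * part (-1) Q) (part 1 P * part (-1) Q)
        + ip (part 1 Q * part (-1) P) (part 1 Q * part (-1) P)
        - 2 * ip (part 1 P * part (-1) P) (part 1 Q * part (-1) Q)
        - 2 / n * frobSq (part 1 (tensTrace 1 (-1) P Q)) := by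
  have hn' : (n : ℝ) ≠ 0 := by exact_mod_cast hn
  set E := part 1 (tensTrace 1 (-1) P Q) with hE
  have hEt : Eᵀ = E := part_one_transpose _
  have hs : ∀ i k l j, mixed P Q i k l j * mixed P Q i l k j
      = tens 1 (-1) P Q i k l j * tens 1 (-1) P Q i l k j
        - 1 / n * (tens 1 (-1) P Q i k l j * corr 1 (-1) E i l k j)
        - 1 / n * (tens 1 (-1) P Q i l k j * corr 1 (-1) E i k l j)
        + (1 / n) ^ 2 * (corr 1 (-1) E i k l j * corr 1 (-1) E i l k j) := by
    intros; simp only [mixed, ← hE]; ring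
  have e1 := sum_mul_corr_swap (f := tens 1 (-1) P Q)
    (fun i k l j => by simpa using tens_swap_left (ε := 1) (by norm_num) (-1) P Q i k l j)
    (fun i k l j => by simpa using tens_swap_right 1 (δ := -1) (by norm_num) P Q i k l j)
    hEt (sum_tens 1 (-1) P Q)
  have e2 : ∑ i, ∑ k, ∑ l, ∑ j, tens 1 (-1) P Q i l k j * corr 1 (-1) E i k l j
      = 2 * ip (tensTrace 1 (-1) P Q) E := by
    rw [← e1]
    exact Finset.sum_congr rfl fun i _ => Finset.sum_comm
  have e3 := sum_mul_corr_swap (f := corr 1 (-1) E) (F := (n : ℝ) • E)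
    (fun i k l j => by simpa using corr_swap_left (ε := 1) (by norm_num) (-1) E i k l j)
    (fun i k l j => by simpa using corr_swap_right 1 (δ := -1) (by norm_num) E i k l j)
    hEt (fun i j => by
      rw [sum_corr 1 (-1) (trace_part_tensTrace P Q)]; simp [← hE])
  have e4 := sum_tens_swap (part 1 P) (part (-1) Q) (part 1 Q) (part (-1) P)
  have e5 : ip (tensTrace 1 (-1) P Q) E = frobSq E := ip_part _
  simp only [hs, Finset.sum_add_distrib, Finset.sum_sub_distrib, ← Finset.mul_sum, e1, e2, e3, e5,
    ip_smul_left]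
  simp only [tens]
  rw [e4, frobSq_eq_ip]
  field_simp
  ring

/-- The mixed block has total weight `(n - 2) / 2 + 2 = (n + 2) / 2`. Its corrections add up to `-2`
times the squared symmetric part of the contraction, as the commutator requires; the skew part
enters the commutator with the opposite sign and so is left over as a square. -/
lemma formVal_eq_sum_sq (hn : n ≠ 0) (P Q : Matrix (Fin n) (Fin n) ℝ) :
    formVal (((n : ℝ) - 2) / 2) P Q
      = (n + 2) / 4 * ∑ i, ∑ k, ∑ l, ∑ j, resid 1 P Q i k l j ^ 2
        + (n + 2) / 4 * ∑ i, ∑ k, ∑ l, ∑ j, resid (-1) P Q i k l j ^ 2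
        + 4 / (n + 2) * ∑ i, ∑ j, tensTrace (-1) (-1) P Q i j ^ 2
        + (n - 2) / 2 * ∑ i, ∑ k, ∑ l, ∑ j, mixed P Q i k l j ^ 2
        + ∑ i, ∑ k, ∑ l, ∑ j, (mixed P Q i k l j - mixed P Q i l k j) ^ 2
        + 2 * ∑ i, ∑ j, part (-1) (tensTrace 1 (-1) P Q) i j ^ 2 := by
  have hn' : (n : ℝ) ≠ 0 := by exact_mod_cast hn
  have hn2 : (n : ℝ) + 2 ≠ 0 := by positivity
  have hsw : ∑ i, ∑ k, ∑ l, ∑ j, (mixed P Q i k l j - mixed P Q i l k j) ^ 2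
      = 2 * ∑ i, ∑ k, ∑ l, ∑ j, mixed P Q i k l j ^ 2
        - 2 * ∑ i, ∑ k, ∑ l, ∑ j, mixed P Q i k l j * mixed P Q i l k j := by
    have h1 : ∑ i, ∑ k, ∑ l, ∑ j, mixed P Q i l k j ^ 2
        = ∑ i, ∑ k, ∑ l, ∑ j, mixed P Q i k l j ^ 2 :=
      Finset.sum_congr rfl fun i _ => Finset.sum_comm
    have hs : ∀ i k l j, (mixed P Q i k l j - mixed P Q i l k j) ^ 2
        = mixed P Q i k l j ^ 2 + mixed P Q i l k j ^ 2
          - 2 * (mixed P Q i k l j * mixed P Q i l k j) := by intros; ring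
    simp only [hs, Finset.sum_add_distrib, Finset.sum_sub_distrib, ← Finset.mul_sum, h1]
    ring
  have hz : ∀ A B : Matrix (Fin n) (Fin n) ℝ, ip (part 1 A) (part (-1) B) = 0 := fun A B => by
    rw [ip_comm]
    exact ip_eq_zero (part_neg_one_transpose B) (part_one_transpose A)
  have hz' : ∀ A B : Matrix (Fin n) (Fin n) ℝ, ip (part (-1) A) (part 1 B) = 0 := fun A B =>
    ip_eq_zero (part_neg_one_transpose A) (part_one_transpose B)
  have hip : ∀ A B : Matrix (Fin n) (Fin n) ℝ,
      ip A B = ip (part 1 A) (part 1 B) + ip (part (-1) A) (part (-1) B) := by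
    intro A B
    conv_lhs => rw [← part_add_part A, ← part_add_part B]
    rw [ip_add_left, ip_add_right, ip_add_right, hz, hz']
    ring
  have hc := ip_commutator (part_one_transpose P) (part_one_transpose Q)
    (part_neg_one_transpose P) (part_neg_one_transpose Q)
  rw [part_add_part, part_add_part] at hc
  have hE := ip_transpose_self (tensTrace 1 (-1) P Q)
  have f1 : ∑ i, ∑ j, tensTrace (-1) (-1) P Q i j ^ 2 = frobSq (tensTrace (-1) (-1) P Q) := rfl
  have f2 : ∑ i, ∑ j, part (-1) (tensTrace 1 (-1) P Q) i j ^ 2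
    = frobSq (part (-1) (tensTrace 1 (-1) P Q)) := rfl
  have g1 : part 1 P * part 1 Q - part 1 Q * part 1 P = tensTrace 1 1 P Q := rfl
  have g2 : part (-1) P * part (-1) Q - part (-1) Q * part (-1) P = tensTrace (-1) (-1) P Q := rfl
  have g3 : part 1 P * part (-1) Q - part 1 Q * part (-1) P = tensTrace 1 (-1) P Q := rfl
  rw [g1, g2, g3, hE] at hc
  rw [hsw, sum_resid_sq (by norm_num), sum_resid_sq (by norm_num), sum_mixed_sq hn,
    sum_mixed_swap hn, f1, f2, formVal, hc]
  have : (Pᵀ * Q).trace = ip P Q := rfl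
  rw [this, frobSq_eq_ip P, frobSq_eq_ip Q, hip P P, hip Q Q, hip P Q]
  simp only [frobSq_eq_ip (part _ P), frobSq_eq_ip (part _ Q)]
  field_simp
  ring

/-! ### Gram matrices with respect to the minors. -/

/-- An alternating bilinear form in the entries of two matrices. -/
def IsAlt (b : (Pos n → ℝ) → (Pos n → ℝ) → ℝ) : Prop :=
  ∃ v : Cand n → ℝ, ∀ p q, b p q = v ⬝ᵥ wedge p q

lemma IsAlt.sub {b b' : (Pos n → ℝ) → (Pos n → ℝ) → ℝ} (h : IsAlt b) (h' : IsAlt b') :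
    IsAlt fun p q => b p q - b' p q := by
  obtain ⟨v, hv⟩ := h
  obtain ⟨v', hv'⟩ := h'
  exact ⟨v - v', fun p q => by simp only [sub_dotProduct, hv, hv']⟩

lemma IsAlt.add {b b' : (Pos n → ℝ) → (Pos n → ℝ) → ℝ} (h : IsAlt b) (h' : IsAlt b') :
    IsAlt fun p q => b p q + b' p q := by
  obtain ⟨v, hv⟩ := h
  obtain ⟨v', hv'⟩ := h'
  exact ⟨v + v', fun p q => by simp only [add_dotProduct, hv, hv']⟩

lemma IsAlt.const_mul {b : (Pos n → ℝ) → (Pos n → ℝ) → ℝ} (h : IsAlt b) (x : ℝ) :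
    IsAlt fun p q => x * b p q := by
  obtain ⟨v, hv⟩ := h
  exact ⟨x • v, fun p q => by simp only [smul_dotProduct, hv, smul_eq_mul]⟩

lemma IsAlt.sum {ι : Type*} {s : Finset ι} {b : ι → (Pos n → ℝ) → (Pos n → ℝ) → ℝ}
    (h : ∀ i, IsAlt (b i)) : IsAlt fun p q => ∑ i ∈ s, b i p q := by
  choose v hv using h
  exact ⟨∑ i ∈ s, v i, fun p q => by simp only [sum_dotProduct, hv]⟩

lemma isAlt_tens (ε δ : ℝ) (i k l j : Fin n) :
    IsAlt fun p q => tens ε δ (toMat p) (toMat q) i k l j := by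
  refine ⟨(1 / 4 : ℝ) • (zvec (pos i k) (pos l j) + ε • zvec (pos k i) (pos l j)
    + δ • zvec (pos i k) (pos j l) + (ε * δ) • zvec (pos k i) (pos j l)), fun p q => ?_⟩
  simp only [smul_dotProduct, add_dotProduct, zvec_dotProduct_wedge, tens, part_apply, toMat_apply,
    smul_eq_mul]
  ring

lemma isAlt_tensTrace (ε δ : ℝ) (i j : Fin n) :
    IsAlt fun p q => tensTrace ε δ (toMat p) (toMat q) i j := by
  simp only [← sum_tens]
  exact IsAlt.sum fun k => isAlt_tens ε δ i k k j

lemma isAlt_part {E : (Pos n → ℝ) → (Pos n → ℝ) → Matrix (Fin n) (Fin n) ℝ}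
    (h : ∀ i j, IsAlt fun p q => E p q i j) (ε : ℝ) (i j : Fin n) :
    IsAlt fun p q => part ε (E p q) i j := by
  simp only [part_apply, div_eq_inv_mul]
  exact ((h i j).add ((h j i).const_mul ε)).const_mul _

lemma isAlt_corr {E : (Pos n → ℝ) → (Pos n → ℝ) → Matrix (Fin n) (Fin n) ℝ}
    (h : ∀ i j, IsAlt fun p q => E p q i j) (ε δ : ℝ) (i k l j : Fin n) :
    IsAlt fun p q => corr ε δ (E p q) i k l j :=
  ((((h i j).const_mul _).add ((h k j).const_mul _)).add ((h i l).const_mul _)).add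
    ((h k l).const_mul _)

lemma isAlt_resid (ε : ℝ) (i k l j : Fin n) :
    IsAlt fun p q => resid ε (toMat p) (toMat q) i k l j :=
  (isAlt_tens ε ε i k l j).sub ((isAlt_corr (isAlt_tensTrace ε ε) ε ε i k l j).const_mul _)

lemma isAlt_mixed (i k l j : Fin n) : IsAlt fun p q => mixed (toMat p) (toMat q) i k l j :=
  (isAlt_tens 1 (-1) i k l j).sub
    ((isAlt_corr (isAlt_part (isAlt_tensTrace 1 (-1)) 1) 1 (-1) i k l j).const_mul _)

/-- A biquadratic form with a positive semidefinite Gram matrix with respect to the minors. -/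
def IsGram (f : (Pos n → ℝ) → (Pos n → ℝ) → ℝ) : Prop :=
  ∃ S : Matrix (Cand n) (Cand n) ℝ, S.PosSemidef ∧
    ∀ p q, f p q = wedge p q ⬝ᵥ (S *ᵥ wedge p q)

lemma IsAlt.sq {b : (Pos n → ℝ) → (Pos n → ℝ) → ℝ} (h : IsAlt b) :
    IsGram fun p q => b p q ^ 2 := by
  obtain ⟨v, hv⟩ := h
  refine ⟨vecMulVec v v, posSemidef_vecMulVec v, fun p q => ?_⟩
  simp only [hv, vecMulVec_mulVec]
  simp [dotProduct_comm, _root_.sq]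

lemma IsGram.add {f g : (Pos n → ℝ) → (Pos n → ℝ) → ℝ} (hf : IsGram f) (hg : IsGram g) :
    IsGram fun p q => f p q + g p q := by
  obtain ⟨S, hS, h⟩ := hf
  obtain ⟨T, hT, h'⟩ := hg
  exact ⟨S + T, hS.add hT, fun p q => by simp only [add_mulVec, dotProduct_add, h, h']⟩

lemma IsGram.zero : IsGram fun _ _ : Pos n → ℝ => 0 :=
  ⟨0, Matrix.PosSemidef.zero, by simp⟩

lemma IsGram.const_mul {f : (Pos n → ℝ) → (Pos n → ℝ) → ℝ} (hf : IsGram f) {x : ℝ} (hx : 0 ≤ x) :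
    IsGram fun p q => x * f p q := by
  obtain ⟨S, hS, h⟩ := hf
  exact ⟨x • S, hS.smul hx, fun p q => by simp only [smul_mulVec, dotProduct_smul, h, smul_eq_mul]⟩

lemma IsGram.sum {ι : Type*} [Fintype ι] {f : ι → (Pos n → ℝ) → (Pos n → ℝ) → ℝ}
    (h : ∀ i, IsGram (f i)) : IsGram fun p q => ∑ i, f i p q := by
  choose S hS h using h
  refine ⟨∑ i, S i, Matrix.posSemidef_sum _ fun i _ => hS i, fun p q => ?_⟩
  simp only [sum_mulVec, dotProduct_sum, h]

lemma isGram_formVal (hn : 2 ≤ n) :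
    IsGram fun p q : Pos n → ℝ => formVal (((n : ℝ) - 2) / 2) (toMat p) (toMat q) := by
  have hn' : (2 : ℝ) ≤ n := by exact_mod_cast hn
  simp only [formVal_eq_sum_sq (by omega : n ≠ 0)]
  refine IsGram.add (IsGram.add (IsGram.add (IsGram.add (IsGram.add ?_ ?_) ?_) ?_) ?_) ?_
  · exact IsGram.const_mul (.sum fun i => .sum fun k => .sum fun l => .sum fun j =>
      (isAlt_resid 1 i k l j).sq) (by positivity)
  · exact IsGram.const_mul (.sum fun i => .sum fun k => .sum fun l => .sum fun j =>
      (isAlt_resid (-1) i k l j).sq) (by positivity)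
  · exact IsGram.const_mul (.sum fun i => .sum fun j => (isAlt_tensTrace (-1) (-1) i j).sq)
      (by positivity)
  · exact IsGram.const_mul (.sum fun i => .sum fun k => .sum fun l => .sum fun j =>
      -- The only coefficient whose sign depends on `2 ≤ n`.
      (isAlt_mixed i k l j).sq) (by linarith)
  · exact .sum fun i => .sum fun k => .sum fun l => .sum fun j =>
      ((isAlt_mixed i k l j).sub (isAlt_mixed i l k j)).sq
  · exact IsGram.const_mul (.sum fun i => .sum fun j =>
      (isAlt_part (isAlt_tensTrace 1 (-1)) (-1) i j).sq) (by norm_num)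

lemma pt_surjective (x : (Fin n × Fin n) ⊕ (Fin n × Fin n) → ℝ) : ∃ p q : Pos n → ℝ, x = pt p q :=
  ⟨fun a => x (Sum.inl (ofLex a)), fun a => x (Sum.inr (ofLex a)), by
    funext a; cases a <;> rfl⟩

/-- The minors as polynomials. -/
def wedgePoly (c : Cand n) : Poly n :=
  MvPolynomial.X (Sum.inl (ofLex c.1.1)) * MvPolynomial.X (Sum.inr (ofLex c.1.2))
    - MvPolynomial.X (Sum.inr (ofLex c.1.1)) * MvPolynomial.X (Sum.inl (ofLex c.1.2))

lemma eval_wedgePoly (p q : Pos n → ℝ) (c : Cand n) :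
    MvPolynomial.eval (pt p q) (wedgePoly c) = wedge p q c := by
  simp [wedgePoly, pt, wedge]

/-- Factoring the Gram matrix as `Bᵀ B` gives squares of linear forms in the minors; polynomials
over `ℝ` that agree at all points are equal. -/
lemma IsGram.isSumSq {F : Poly n} (h : IsGram fun p q => MvPolynomial.eval (pt p q) F) :
    IsSumSq F := by
  obtain ⟨S, hS, h⟩ := h
  obtain ⟨B, rfl⟩ := hS.exists_eq_transpose_mul_self
  have hF : F = ∑ c, (∑ d, MvPolynomial.C (B c d) * wedgePoly d) ^ 2 := by
    refine MvPolynomial.funext fun x => ?_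
    obtain ⟨p, q, rfl⟩ := pt_surjective x
    refine (h p q).trans ?_
    rw [← Matrix.mulVec_mulVec, Matrix.dotProduct_mulVec, Matrix.vecMul_transpose]
    simp [eval_wedgePoly, dotProduct, Matrix.mulVec, sq]
  rw [hF]
  exact IsSumSq.sum_sq _ _

/-! ### From sums of squares back to Gram matrices. -/

section Ray

open Polynomial

variable {σ : Type*}

/-- The restriction of a polynomial to the line through the origin and `x`. -/
def ray (x : σ → ℝ) : MvPolynomial σ ℝ →ₐ[ℝ] ℝ[X] :=
  MvPolynomial.aeval fun v => C (x v) * X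

lemma eval_ray (x : σ → ℝ) (f : MvPolynomial σ ℝ) (t : ℝ) :
    (ray x f).eval t = MvPolynomial.eval (t • x) f := by
  induction f using MvPolynomial.induction_on with
  | C a => simp [ray]
  | add f g hf hg => simp [hf, hg]
  | mul_X f v hf => rw [map_mul, Polynomial.eval_mul, hf]; simp [ray, mul_comm t]

lemma ray_eq_zero {x : σ → ℝ} {f : MvPolynomial σ ℝ}
    (h : ∀ t : ℝ, MvPolynomial.eval (t • x) f = 0) : ray x f = 0 :=
  Polynomial.funext fun t => by rw [eval_ray, h, Polynomial.eval_zero]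

/-- The terms of degree at most two of a polynomial along lines through the origin. -/
lemma exists_coeff_ray [Fintype σ] (f : MvPolynomial σ ℝ) :
    ∃ (a : ℝ) (b : σ → ℝ) (A : σ → σ → ℝ), ∀ x : σ → ℝ, (ray x f).coeff 0 = a ∧
      (ray x f).coeff 1 = ∑ u, b u * x u ∧ (ray x f).coeff 2 = ∑ u, ∑ v, A u v * (x u * x v) := by
  classical
  induction f using MvPolynomial.induction_on with
  | C a => exact ⟨a, 0, 0, fun x => by simp [ray, coeff_C]⟩
  | add f g hf hg =>
    obtain ⟨a, b, A, h⟩ := hf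
    obtain ⟨a', b', A', h'⟩ := hg
    refine ⟨a + a', b + b', A + A', fun x => ?_⟩
    simp [h x, h' x, add_mul, Finset.sum_add_distrib]
  | mul_X f v hf =>
    obtain ⟨a, b, A, h⟩ := hf
    -- Multiplication by the variable `v` shifts degrees by one: the constant term becomes linear
    -- and the linear term quadratic.
    refine ⟨0, Pi.single v a, fun u => Pi.single v (b u), fun x => ?_⟩
    have e : ray x (f * MvPolynomial.X v) = ray x f * C (x v) * X := by
      rw [map_mul, mul_assoc]; simp [ray]
    refine ⟨by simp [e], ?_, ?_⟩
    · rw [e, coeff_mul_X, coeff_mul_C, (h x).1]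
      simp [Pi.single_apply]
    · rw [e, coeff_mul_X, coeff_mul_C, (h x).2.1, Finset.sum_mul]
      simp [Pi.single_apply, mul_assoc]

end Ray

lemma smul_pt (t : ℝ) (p q : Pos n → ℝ) : t • pt p q = pt (t • p) (t • q) := by
  funext a; cases a <;> simp [pt]

lemma add_pt (p q p' q' : Pos n → ℝ) : pt p q + pt p' q' = pt (p + p') (q + q') := by
  funext a; cases a <;> simp [pt]

/-- Vanishing when one of the matrices is zero or when both coincide. -/
structure VanishesAtDegenerate (f : Poly n) : Prop where
  right : ∀ p, MvPolynomial.eval (pt p 0) f = 0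
  left : ∀ q, MvPolynomial.eval (pt 0 q) f = 0
  diag : ∀ p, MvPolynomial.eval (pt p p) f = 0

/-- Vanishing at `(p, 0)` and `(0, q)` kills the constant and linear terms and makes the quadratic
term bilinear in `p` and `q`; vanishing at `(p, p)` makes it alternating. -/
lemma VanishesAtDegenerate.coeff_ray {f : Poly n} (h : VanishesAtDegenerate f) :
    (∀ p q, (ray (pt p q) f).coeff 0 = 0) ∧ (∀ p q, (ray (pt p q) f).coeff 1 = 0) ∧
      IsAlt fun p q => (ray (pt p q) f).coeff 2 := by
  have r0 : ∀ p, ray (pt p 0) f = 0 := fun p => ray_eq_zero fun t => by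
    rw [smul_pt, smul_zero]; exact h.right _
  have l0 : ∀ q, ray (pt 0 q) f = 0 := fun q => ray_eq_zero fun t => by
    rw [smul_pt, smul_zero]; exact h.left _
  have d0 : ∀ p, ray (pt p p) f = 0 := fun p => ray_eq_zero fun t => by
    rw [smul_pt]; exact h.diag _
  obtain ⟨a, b, A, hf⟩ := exists_coeff_ray f
  have ha : a = 0 := by rw [← (hf (pt 0 0)).1, r0, Polynomial.coeff_zero]
  refine ⟨fun p q => by rw [(hf _).1, ha], fun p q => ?_, ?_⟩
  · have e1 := (hf (pt p 0)).2.1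
    have e2 := (hf (pt 0 q)).2.1
    rw [r0, Polynomial.coeff_zero] at e1
    rw [l0, Polynomial.coeff_zero] at e2
    have e : pt p q = pt p 0 + pt 0 q := by rw [add_pt, add_zero, zero_add]
    rw [(hf _).2.1, e]
    simp only [Pi.add_apply, mul_add, Finset.sum_add_distrib, ← e1, ← e2, add_zero]
  · set B : Pos n → Pos n → ℝ := fun a b =>
      A (Sum.inl (ofLex a)) (Sum.inr (ofLex b)) + A (Sum.inr (ofLex b)) (Sum.inl (ofLex a)) with hB
    have key : ∀ p q, (ray (pt p q) f).coeff 2 = ∑ a, ∑ b, B a b * (p a * q b) := by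
      intro p q
      have e1 := (hf (pt p 0)).2.2
      have e2 := (hf (pt 0 q)).2.2
      rw [r0, Polynomial.coeff_zero] at e1
      rw [l0, Polynomial.coeff_zero] at e2
      rw [(hf _).2.2]
      simp only [Fintype.sum_sum_type, pt, Sum.elim_inl, Sum.elim_inr, Pi.zero_apply, mul_zero,
        zero_mul, Finset.sum_const_zero, add_zero, zero_add] at e1 e2 ⊢
      have hl : ∀ g : Pos n → ℝ, ∑ a, g a = ∑ a : Fin n × Fin n, g (toLex a) := fun g =>
        (Equiv.sum_comp toLex g).symm
      simp only [hl, hB, ofLex_toLex, add_mul, Finset.sum_add_distrib, ← e1, ← e2, zero_add,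
        add_zero]
      congr 1
      rw [Finset.sum_comm]
      simp only [mul_comm (q _)]
    have hanti : ∀ p q, (ray (pt p q) f).coeff 2 = -(ray (pt q p) f).coeff 2 := by
      intro p q
      have e0 : (ray (pt (p + q) (p + q)) f).coeff 2 = 0 := by rw [d0, Polynomial.coeff_zero]
      have e1 : (ray (pt p p) f).coeff 2 = 0 := by rw [d0, Polynomial.coeff_zero]
      have e2 : (ray (pt q q) f).coeff 2 = 0 := by rw [d0, Polynomial.coeff_zero]
      rw [key] at e0 e1 e2
      rw [key, key]
      simp only [Pi.add_apply, add_mul, mul_add, Finset.sum_add_distrib, e1, e2] at e0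
      linarith
    -- Averaging an antisymmetric form with minus its swap turns each `p_a q_b` into half a minor.
    refine ⟨(1 / 2 : ℝ) • ∑ a, ∑ b, B a b • zvec a b, fun p q => ?_⟩
    have e : (ray (pt p q) f).coeff 2
        = 1 / 2 * ((ray (pt p q) f).coeff 2 - (ray (pt q p) f).coeff 2) := by
      rw [hanti q p]; ring
    simp only [smul_dotProduct, sum_dotProduct, zvec_dotProduct_wedge, smul_eq_mul]
    rw [e, key, key]
    simp only [mul_sub, Finset.sum_sub_distrib]

lemma eval_nonneg {σ : Type*} {f : MvPolynomial σ ℝ} (hf : IsSumSq f) (x : σ → ℝ) :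
    0 ≤ MvPolynomial.eval x f := by
  induction hf with
  | zero => simp
  | sq_add a hs ih =>
    rw [map_add, map_mul]
    exact add_nonneg (mul_self_nonneg _) ih

/-- Over `ℝ`, every summand vanishes where the sum does. Along a ray `a` then starts in degree two,
so the fourth coefficient of `a * a` is the square of the second coefficient of `a`; no homogeneity
or degree bound on `a` is needed. -/
lemma isGram_coeff_ray {f : Poly n} (hf : IsSumSq f) (h : VanishesAtDegenerate f) :
    IsGram fun p q => (ray (pt p q) f).coeff 4 := by
  induction hf with
  | zero => simpa using IsGram.zero
  | @sq_add a s hs ih =>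
    have hnn : ∀ x, 0 ≤ MvPolynomial.eval x s := eval_nonneg hs
    have key : ∀ x, MvPolynomial.eval x (a * a + s) = 0 →
        MvPolynomial.eval x a = 0 ∧ MvPolynomial.eval x s = 0 := by
      intro x hx
      rw [map_add, map_mul] at hx
      have h1 := mul_self_nonneg (MvPolynomial.eval x a)
      have h2 := hnn x
      exact ⟨mul_self_eq_zero.mp (by linarith), by linarith⟩
    have va : VanishesAtDegenerate a :=
      ⟨fun p => (key _ (h.right p)).1, fun p => (key _ (h.left p)).1, fun p => (key _ (h.diag p)).1⟩
    have vs : VanishesAtDegenerate s :=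
      ⟨fun p => (key _ (h.right p)).2, fun p => (key _ (h.left p)).2, fun p => (key _ (h.diag p)).2⟩
    obtain ⟨c0, c1, c2⟩ := va.coeff_ray
    have e : ∀ p q, (ray (pt p q) (a * a + s)).coeff 4
        = (ray (pt p q) a).coeff 2 ^ 2 + (ray (pt p q) s).coeff 4 := by
      intro p q
      rw [map_add, map_mul, Polynomial.coeff_add, Polynomial.coeff_mul]
      simp [Finset.Nat.antidiagonal_succ, c0, c1, sq]
    simp only [e]
    exact c2.sq.add (ih vs)

lemma coeff_ray_form (γ : ℝ) (p q : Pos n → ℝ) :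
    (ray (pt p q) (form n γ)).coeff 4 = formVal γ (toMat p) (toMat q) := by
  have : ray (pt p q) (form n γ)
      = Polynomial.C (formVal γ (toMat p) (toMat q)) * Polynomial.X ^ 4 := by
    refine Polynomial.funext fun t => ?_
    rw [eval_ray, smul_pt, eval_form, formVal_eq, formVal_eq]
    have hw : wedge (t • p) (t • q) = t ^ 2 • wedge p q := by
      funext c; simp only [wedge, Pi.smul_apply, smul_eq_mul]; ring
    simp only [hw, mulVec_smul, dotProduct_smul, smul_dotProduct, smul_eq_mul,
      Polynomial.eval_mul, Polynomial.eval_C, Polynomial.eval_pow, Polynomial.eval_X]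
    ring
  rw [this, Polynomial.coeff_C_mul_X_pow]
  simp

lemma vanishesAtDegenerate_form (γ : ℝ) : VanishesAtDegenerate (form n γ) := by
  have h : ∀ p q : Pos n → ℝ, wedge p q = 0 → MvPolynomial.eval (pt p q) (form n γ) = 0 := by
    intro p q hw
    rw [eval_form, formVal_eq, hw, zero_dotProduct]
  exact ⟨fun p => h _ _ (by funext c; simp [wedge]), fun p => h _ _ (by funext c; simp [wedge]),
    fun p => h _ _ (by funext c; simp [wedge])⟩

/-! ### Dual feasibility and weak duality. -/

lemma exists_dualFeasible_of_isGram {γ : ℝ}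
    (h : IsGram fun p q : Pos n → ℝ => formVal γ (toMat p) (toMat q)) :
    ∃ y : Quad n → ℝ, DualFeasible y (-γ) := by
  obtain ⟨S, hS, h⟩ := h
  have hSt : Sᵀ = S := by
    have := hS.isHermitian
    rwa [Matrix.IsHermitian, Matrix.conjTranspose_eq_transpose_of_trivial] at this
  obtain ⟨y, hy⟩ := exists_eq_sum_matA
    (M := matC n + γ • (1 : Matrix (Cand n) (Cand n) ℝ) - S)
    (by simp [matC_transpose, hSt]) (fun p q => by
      rw [sub_mulVec, dotProduct_sub, ← formVal_eq, ← h p q, sub_self])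
  refine ⟨y, ?_⟩
  have : slack y (-γ) = S := by
    rw [slack, ← hy]; module
  rwa [DualFeasible, this]

lemma exists_dualFeasible_of_isSumSq {γ : ℝ} (h : IsSumSq (form n γ)) :
    ∃ y : Quad n → ℝ, DualFeasible y (-γ) :=
  exists_dualFeasible_of_isGram <| by
    simpa only [coeff_ray_form] using isGram_coeff_ray h (vanishesAtDegenerate_form γ)

lemma isSumSq_form (hn : 2 ≤ n) : IsSumSq (form n (((n : ℝ) - 2) / 2)) :=
  IsGram.isSumSq (by simpa only [eval_form] using isGram_formVal hn)

lemma le_trace_of_dualFeasible {X : Matrix (Cand n) (Cand n) ℝ} (hX : PrimalFeasible X)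
    {y : Quad n → ℝ} {s : ℝ} (hy : DualFeasible y s) : s ≤ (matC n * X).trace := by
  have h := Matrix.PosSemidef.trace_mul_nonneg hy hX.1
  rw [slack, Matrix.sub_mul, Matrix.sub_mul, Matrix.trace_sub, Matrix.trace_sub, Matrix.sum_mul,
    Matrix.trace_sum] at h
  simp only [Matrix.smul_mul, Matrix.trace_smul, hX.2.1, hX.2.2, Matrix.one_mul, smul_eq_mul, mul_zero,
    Finset.sum_const_zero, mul_one, sub_zero] at h
  linarith

/-! ### The optimal primal solution. -/

/-- The pairs `g < h` of indices. -/
abbrev Edge (n : ℕ) : Type := {e : Fin n × Fin n // e.1 < e.2}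

lemma card_edge (n : ℕ) : Fintype.card (Edge n) = n.choose 2 := by
  let φ : Edge n ≃ Σ j : Fin n, Fin j :=
    { toFun := fun e => ⟨e.1.2, ⟨e.1.1, e.2⟩⟩
      invFun := fun x => ⟨(⟨x.2, x.2.2.trans x.1.2⟩, x.1), x.2.2⟩
      left_inv := fun _ => rfl
      right_inv := fun _ => rfl }
  rw [Fintype.card_congr φ, Fintype.card_sigma]
  simp only [Fintype.card_fin]
  rw [Fin.sum_univ_eq_sum_range (fun i => i) n, Finset.sum_range_id, Nat.choose_two_right]

lemma sum_eq_two_mul_sum_edge {f : Fin n → Fin n → ℝ} (h : ∀ i j, f j i = f i j)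
    (h0 : ∀ i, f i i = 0) : ∑ i, ∑ j, f i j = 2 * ∑ e : Edge n, f e.1.1 e.1.2 := by
  have e1 : ∑ i, ∑ j, (if i < j then f i j else 0) = ∑ e : Edge n, f e.1.1 e.1.2 := by
    rw [← Fintype.sum_prod_type' (f := fun i j => if i < j then f i j else 0),
      ← Finset.sum_filter]
    exact Finset.sum_subtype _ (by simp) _
  have e2 : ∑ i, ∑ j, (if j < i then f i j else 0) = ∑ i, ∑ j, (if i < j then f i j else 0) := by
    rw [Finset.sum_comm]
    simp only [h]
  have e3 : ∀ i j, f i j = (if i < j then f i j else 0) + (if j < i then f i j else 0) := by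
    intro i j
    rcases lt_trichotomy i j with hij | hij | hij
    · simp [hij, hij.not_gt]
    · subst hij; simp [h0]
    · simp [hij, hij.not_gt]
  calc ∑ i, ∑ j, f i j
      = ∑ i, ∑ j, ((if i < j then f i j else 0) + (if j < i then f i j else 0)) :=
        Finset.sum_congr rfl fun i _ => Finset.sum_congr rfl fun j _ => e3 i j
    _ = 2 * ∑ e : Edge n, f e.1.1 e.1.2 := by
        simp only [Finset.sum_add_distrib, e2, e1]; ring

/-- The coefficient vector of the `(g, h)` entry of the commutator of `P + Pᵀ` and `Q + Qᵀ`. -/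
def symCommVec (g h : Fin n) : Cand n → ℝ :=
  ∑ k, (zvec (pos g k) (pos k h) + zvec (pos k g) (pos k h) + zvec (pos g k) (pos h k)
    + zvec (pos k g) (pos h k))

/-- The skew-symmetric matrix unit. -/
def skewUnit (g h : Fin n) : Matrix (Fin n) (Fin n) ℝ :=
  Matrix.of fun i j => (if i = g ∧ j = h then 1 else 0) - (if i = h ∧ j = g then 1 else 0)

lemma trace_skewUnit (g h : Fin n) : (skewUnit g h).trace = 0 := by
  simp [Matrix.trace, skewUnit, and_comm]

lemma pos_inj {i k i' k' : Fin n} : pos i k = pos i' k' ↔ i = i' ∧ k = k' := by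
  simp [pos]

/-- Identifies `symCommVec` with a delta tensor, so that the contraction formula `sum_corr` yields
all inner products needed below. -/
lemma zvec_dotProduct_symCommVec (g h i k l j : Fin n) :
    zvec (pos i k) (pos l j) ⬝ᵥ symCommVec g h = corr 1 1 (skewUnit g h) i k l j := by
  have hsub : ∀ (p : Prop) [Decidable p] (x y : ℝ), (if p then x - y else 0)
      = (if p then x else 0) - (if p then y else 0) := by
    intro p _ x y; split_ifs <;> simp
  have hmul : ∀ (p q r : Prop) [Decidable p] [Decidable q] [Decidable r],
      (if p then if q then if r then (1 : ℝ) else 0 else 0 else 0)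
      = (if p then 1 else 0) * (if q then 1 else 0) * (if r then 1 else 0) := by
    intro p q r _ _ _; split_ifs <;> simp
  have hsymm : ∀ a b : Fin n, (if a = b then (1 : ℝ) else 0) = if b = a then 1 else 0 :=
    fun a b => if_congr eq_comm rfl rfl
  rw [dotProduct_comm]
  simp only [symCommVec, sum_dotProduct, add_dotProduct, zvec_dotProduct_zvec, pos_inj, corr,
    skewUnit, Matrix.of_apply, Finset.sum_add_distrib, Finset.sum_sub_distrib, ite_and]
  simp
  simp only [hsub]
  simp only [hmul]
  rw [hsymm g i, hsymm g k, hsymm g l, hsymm g j, hsymm h i, hsymm h k, hsymm h l, hsymm h j,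
    hsymm j i, hsymm j k, hsymm l i, hsymm l k]
  ring

lemma commVec_dotProduct_symCommVec (g h i j : Fin n) :
    commVec i j ⬝ᵥ symCommVec g h = (n + 2) * skewUnit g h i j := by
  simp only [commVec, sum_dotProduct, zvec_dotProduct_symCommVec, sum_corr 1 1 (trace_skewUnit g h)]
  ring

lemma symCommVec_dotProduct_symCommVec (g h i j : Fin n) :
    symCommVec i j ⬝ᵥ symCommVec g h = 4 * (n + 2) * skewUnit g h i j := by
  have hc := sum_corr 1 1 (trace_skewUnit g h) i j
  have h1 : ∀ i k l j, corr 1 1 (skewUnit g h) k i l j = corr 1 1 (skewUnit g h) i k l j :=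
    fun i k l j => by simpa using corr_swap_left (ε := 1) (by norm_num) 1 (skewUnit g h) i k l j
  have h2 : ∀ i k l j, corr 1 1 (skewUnit g h) i k j l = corr 1 1 (skewUnit g h) i k l j :=
    fun i k l j => by simpa using corr_swap_right 1 (δ := 1) (by norm_num) (skewUnit g h) i k l j
  rw [symCommVec, sum_dotProduct]
  simp only [add_dotProduct, zvec_dotProduct_symCommVec]
  have : ∀ k, corr 1 1 (skewUnit g h) i k k j + corr 1 1 (skewUnit g h) k i k j
      + corr 1 1 (skewUnit g h) i k j k + corr 1 1 (skewUnit g h) k i j k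
      = 4 * corr 1 1 (skewUnit g h) i k k j := by
    intro k
    rw [h2 k i k j, h2 i k k j, h1 i k k j]; ring
  rw [Finset.sum_congr rfl fun k _ => this k, ← Finset.mul_sum, hc]
  ring

/-- The symmetric matrix unit at a position. -/
def symUnit (a : Pos n) : Matrix (Fin n) (Fin n) ℝ :=
  toMat (Pi.single a 1) + (toMat (Pi.single a 1))ᵀ

lemma symUnit_transpose (a : Pos n) : (symUnit a)ᵀ = symUnit a := by
  simp [symUnit, add_comm]

lemma symCommVec_dotProduct_zvec (g h : Fin n) (a b : Pos n) :
    symCommVec g h ⬝ᵥ zvec a b = (symUnit a * symUnit b - symUnit b * symUnit a) g h := by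
  rw [← wedge_single]
  simp only [symCommVec, sum_dotProduct, add_dotProduct, zvec_dotProduct_wedge, symUnit,
    Matrix.sub_apply, Matrix.mul_apply, Matrix.add_apply, Matrix.transpose_apply, toMat_apply,
    ← Finset.sum_sub_distrib]
  exact Finset.sum_congr rfl fun k _ => by ring

lemma ip_commutator_eq_trace {A B : Matrix (Fin n) (Fin n) ℝ} (hA : Aᵀ = A) (hB : Bᵀ = B)
    (X : Matrix (Fin n) (Fin n) ℝ) : ip (A * B - B * A) X = -(A * (B * X - X * B)).trace := by
  have h : (B * A * X).trace = (A * (X * B)).trace := by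
    rw [Matrix.mul_assoc, Matrix.trace_mul_comm, Matrix.mul_assoc]
  rw [ip, Matrix.transpose_sub, Matrix.transpose_mul, Matrix.transpose_mul, hA, hB, Matrix.sub_mul,
    Matrix.trace_sub, h, Matrix.mul_sub, Matrix.trace_sub, Matrix.mul_assoc]
  ring

/-- The alternating sum of inner products of commutators vanishes by the Jacobi identity. -/
lemma ip_commutator_jacobi {A B C D : Matrix (Fin n) (Fin n) ℝ} (hA : Aᵀ = A) (hB : Bᵀ = B)
    (hC : Cᵀ = C) (hD : Dᵀ = D) :
    ip (A * B - B * A) (C * D - D * C) + ip (A * D - D * A) (B * C - C * B)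
      - ip (A * C - C * A) (B * D - D * B) = 0 := by
  rw [ip_commutator_eq_trace hA hB, ip_commutator_eq_trace hA hC, ip_commutator_eq_trace hA hD,
    sub_neg_eq_add, ← neg_add, neg_add_eq_sub, ← Matrix.trace_add, ← Matrix.trace_sub,
    ← Matrix.mul_add, ← Matrix.mul_sub]
  -- The Jacobi identity for `B`, `C`, `D`.
  have : C * (B * D - D * B) - (B * D - D * B) * C - (B * (C * D - D * C) - (C * D - D * C) * B
      + (D * (B * C - C * B) - (B * C - C * B) * D)) = 0 := by noncomm_ring
  rw [this, Matrix.mul_zero, Matrix.trace_zero]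

/-- The matrix whose columns are the vectors `symCommVec g h`. -/
def cols (n : ℕ) : Matrix (Cand n) (Edge n) ℝ := Matrix.of fun c e => symCommVec e.1.1 e.1.2 c

lemma trace_mul_cols (M : Matrix (Cand n) (Cand n) ℝ) :
    (M * (cols n * (cols n)ᵀ)).trace
      = ∑ e : Edge n, symCommVec e.1.1 e.1.2 ⬝ᵥ (M *ᵥ symCommVec e.1.1 e.1.2) := by
  rw [← Matrix.mul_assoc, Matrix.trace_mul_comm]
  rfl

lemma dotProduct_symProd (u v w : Cand n → ℝ) :
    w ⬝ᵥ (symProd u v *ᵥ w) = 2 * ((w ⬝ᵥ u) * (w ⬝ᵥ v)) := by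
  simp only [symProd, add_mulVec, dotProduct_add, vecMulVec_mulVec]
  simp only [op_smul_eq_smul, smul_dotProduct, smul_eq_mul, dotProduct_comm w]
  ring

lemma sum_symCommVec_zvec (a b c d : Pos n) :
    2 * ∑ e : Edge n, (symCommVec e.1.1 e.1.2 ⬝ᵥ zvec a b) * (symCommVec e.1.1 e.1.2 ⬝ᵥ zvec c d)
      = ip (symUnit a * symUnit b - symUnit b * symUnit a)
          (symUnit c * symUnit d - symUnit d * symUnit c) := by
  have hs : ∀ a b : Pos n, ∀ i j, (symUnit a * symUnit b - symUnit b * symUnit a) j i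
      = -(symUnit a * symUnit b - symUnit b * symUnit a) i j := by
    intro a b i j
    have : (symUnit a * symUnit b - symUnit b * symUnit a)ᵀ
        = -(symUnit a * symUnit b - symUnit b * symUnit a) := by
      simp [symUnit_transpose]
    exact congrFun (congrFun this i) j
  simp only [symCommVec_dotProduct_zvec]
  rw [ip_eq_sum, sum_eq_two_mul_sum_edge]
  · intro i j
    rw [hs a b i j, hs c d i j]; ring
  · intro i
    have := hs a b i i
    rw [show (symUnit a * symUnit b - symUnit b * symUnit a) i i = 0 by linarith, zero_mul]

lemma trace_matA_mul_cols (t : Quad n) : (matA t * (cols n * (cols n)ᵀ)).trace = 0 := by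
  rw [trace_mul_cols]
  simp only [matA, sub_mulVec, add_mulVec, dotProduct_sub, dotProduct_add, dotProduct_symProd,
    Finset.sum_sub_distrib, Finset.sum_add_distrib, ← Finset.mul_sum, sum_symCommVec_zvec]
  exact ip_commutator_jacobi (symUnit_transpose _) (symUnit_transpose _) (symUnit_transpose _)
    (symUnit_transpose _)

lemma skewUnit_self (e : Edge n) : skewUnit e.1.1 e.1.2 e.1.1 e.1.2 = 1 := by
  simp [skewUnit, e.2.ne]

lemma sum_skewUnit_sq (e : Edge n) : ∑ i, ∑ j, skewUnit e.1.1 e.1.2 i j ^ 2 = 2 := by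
  have h : ∀ i j, skewUnit e.1.1 e.1.2 i j ^ 2
      = (if i = e.1.1 then (if j = e.1.2 then 1 else 0) else 0)
        + (if i = e.1.2 then (if j = e.1.1 then 1 else 0) else 0) := by
    intro i j
    have := e.2.ne
    simp only [skewUnit, Matrix.of_apply, ite_and]
    split_ifs <;> simp_all
  simp only [h, Finset.sum_add_distrib]
  simp
  norm_num

/-- The value is `2 * 4 (n + 2) - 2 (n + 2) ^ 2`: twice the squared length, minus the squared norm
of `(n + 2)` times a skew unit. -/
lemma dotProduct_matC_symCommVec (e : Edge n) :
    symCommVec e.1.1 e.1.2 ⬝ᵥ (matC n *ᵥ symCommVec e.1.1 e.1.2)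
      = 4 * (n + 2) * ((2 - n) / 2) := by
  rw [dotProduct_matC, symCommVec_dotProduct_symCommVec, skewUnit_self]
  simp only [commVec_dotProduct_symCommVec, mul_pow, ← Finset.mul_sum, sum_skewUnit_sq]
  ring

lemma cols_transpose_mul_cols :
    (cols n)ᵀ * cols n = (4 * (n + 2) : ℝ) • (1 : Matrix (Edge n) (Edge n) ℝ) := by
  ext e f
  have : ((cols n)ᵀ * cols n) e f = symCommVec e.1.1 e.1.2 ⬝ᵥ symCommVec f.1.1 f.1.2 := rfl
  rw [this, symCommVec_dotProduct_symCommVec, Matrix.smul_apply, smul_eq_mul]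
  congr 1
  obtain ⟨⟨a, b⟩, hab⟩ := e
  obtain ⟨⟨c, d⟩, hcd⟩ := f
  simp only at hab hcd
  have : ¬ (a = d ∧ b = c) := by
    rintro ⟨rfl, rfl⟩
    exact lt_asymm hab hcd
  simp [skewUnit, this, Matrix.one_apply]

lemma rank_cols_mul_transpose : (cols n * (cols n)ᵀ).rank = n.choose 2 := by
  have h4 : (4 * (n + 2) : ℝ) ≠ 0 := by positivity
  rw [Matrix.rank_self_mul_transpose, ← Matrix.rank_transpose_mul_self, cols_transpose_mul_cols,
    Matrix.rank_smul_of_mem_nonZeroDivisors _ (mem_nonZeroDivisors_of_ne_zero h4),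
    Matrix.rank_one, card_edge]

/-- The optimal solution of the primal program. -/
def primalSol (n : ℕ) : Matrix (Cand n) (Cand n) ℝ :=
  (1 / (4 * (n + 2) * (n.choose 2 : ℝ))) • (cols n * (cols n)ᵀ)

lemma choose_two_pos (hn : 2 ≤ n) : (0 : ℝ) < n.choose 2 := by
  exact_mod_cast Nat.choose_pos hn

lemma primalFeasible_primalSol (hn : 2 ≤ n) : PrimalFeasible (primalSol n) := by
  have h2 := choose_two_pos hn
  refine ⟨?_, fun t => ?_, ?_⟩
  · refine Matrix.PosSemidef.smul ?_ (by positivity)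
    simpa using Matrix.posSemidef_self_mul_conjTranspose (cols n)
  · rw [primalSol, Matrix.mul_smul, Matrix.trace_smul, trace_matA_mul_cols, smul_zero]
  · rw [primalSol, Matrix.trace_smul, ← Matrix.one_mul (cols n * (cols n)ᵀ), trace_mul_cols]
    simp only [Matrix.one_mulVec, symCommVec_dotProduct_symCommVec, skewUnit_self, mul_one,
      Finset.sum_const, Finset.card_univ, card_edge, nsmul_eq_mul, smul_eq_mul]
    field_simp

lemma rank_primalSol (hn : 2 ≤ n) : (primalSol n).rank = n.choose 2 := by
  have h2 := choose_two_pos hn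
  have h : 1 / (4 * (n + 2) * (n.choose 2 : ℝ)) ≠ 0 := by positivity
  rw [primalSol, Matrix.rank_smul_of_mem_nonZeroDivisors _ (mem_nonZeroDivisors_of_ne_zero h),
    rank_cols_mul_transpose]

lemma trace_matC_mul_primalSol (hn : 2 ≤ n) :
    (matC n * primalSol n).trace = (2 - (n : ℝ)) / 2 := by
  have h2 := choose_two_pos hn
  rw [primalSol, Matrix.mul_smul, Matrix.trace_smul, trace_mul_cols]
  simp only [dotProduct_matC_symCommVec, Finset.sum_const, Finset.card_univ, card_edge,
    nsmul_eq_mul, smul_eq_mul]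
  field_simp

end

end BW

theorem theorem1 (n : ℕ) (hn : 2 ≤ n) :
    IsLeast {γ : ℝ | IsSumSq (BW.form n γ)} (((n : ℝ) - 2) / 2) ∧
    (∃ X : Matrix (BW.Cand n) (BW.Cand n) ℝ,
      BW.PrimalFeasible X ∧ X.rank = n.choose 2 ∧
      (BW.matC n * X).trace = (2 - (n : ℝ)) / 2 ∧
      ∀ X' : Matrix (BW.Cand n) (BW.Cand n) ℝ,
        BW.PrimalFeasible X' → (BW.matC n * X).trace ≤ (BW.matC n * X').trace) ∧
    (∃ y : BW.Quad n → ℝ,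
      BW.DualFeasible y ((2 - (n : ℝ)) / 2) ∧
      ∀ (y' : BW.Quad n → ℝ) (s : ℝ), BW.DualFeasible y' s → s ≤ (2 - (n : ℝ)) / 2) := by
  have hX := BW.primalFeasible_primalSol hn
  have hC := BW.trace_matC_mul_primalSol hn
  have hle : ∀ (y : BW.Quad n → ℝ) (s : ℝ), BW.DualFeasible y s → s ≤ (2 - (n : ℝ)) / 2 :=
    fun y s hy => hC ▸ BW.le_trace_of_dualFeasible hX hy
  obtain ⟨y, hy⟩ := BW.exists_dualFeasible_of_isSumSq (BW.isSumSq_form hn)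
  rw [show -(((n : ℝ) - 2) / 2) = (2 - (n : ℝ)) / 2 by ring] at hy
  refine ⟨⟨BW.isSumSq_form hn, fun γ hγ => ?_⟩,
    ⟨BW.primalSol n, hX, BW.rank_primalSol hn, hC, fun X' hX' => ?_⟩, ⟨y, hy, hle⟩⟩
  -- Any sum of squares gives a dual point with `s = -γ`, which the primal solution bounds by `(2 -
  -- n) / 2`.
  · obtain ⟨y', hy'⟩ := BW.exists_dualFeasible_of_isSumSq hγ
    have := hle y' _ hy'
    linarith
  · rw [hC]
    exact BW.le_trace_of_dualFeasible hX' hy
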